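/- Let $M$ be a smooth (Hausdorff, finite-dimensional) manifold and $\mathbb K=\mathbb R$ or $\mathbb C$. Let $\mathrm{UConf}(M)=\bigsqcup_{k\ge 0}\mathrm{UConf}_k(M)$ be its unordered configuration space, i.e. the set of finite subsets of $M$, where $\mathrm{UConf}_k(M)=\mathrm{OConf}_k(M)/S_k$ is the smooth quotient of the open set $\mathrm{OConf}_k(M)\subset M^k$ of $k$-tuples of distinct points. Let $\mathcal{VB}(\mathrm{UConf}(M))$ be the category of smooth $\mathbb K$-vector bundles over $\mathrm{UConf}(M)$ of finite, locally constant rank and smooth fibrewise linear maps over the identity. For $\mathbf V,\mathbf W$ in this category let $\mathbf V\otimes\mathbf W$ (Hadamard tensor product) be the bundle with fibres $\mathbf V_{\underline x}\otimes\mathbf W_{\underline x}$, and $\mathbf V\boxtimes\mathbf W$ (Cauchy tensor product) the bundle with fibres $$(\mathbf V\boxtimes\mathbf W)_{\underline x}=\bigoplus_{\underline x=\underline x'\sqcup\underline x''}\mathbf V_{\underline x'}\otimes\mathbf W_{\underline x''}$$ (sum over all ordered splits of $\underline x$ into two disjoint configurations), where the smooth structure of $\mathbf V\boxtimes\mathbf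 W$ is the one in which, for disjoint open $U_1,\dots,U_k\subset M$, the tensors of smooth local frames of $\mathbf V$ and $\mathbf W$ at complementary parts of the configurations $\{x_1,\dots,x_k\}$, $x_i\in U_i$, form smooth local frames. Let $\mathbf I_\otimes=\mathrm{UConf}(M)\times\mathbb K$, and let $\mathbf I_\boxtimes$ be the bundle with fibre $\mathbb K$ over $\emptyset$ and $0$ over all other configurations. Then $\otimes$ and $\boxtimes$, with units $\mathbf I_\otimes$ and $\mathbf I_\boxtimes$ and the evident tensor products of morphisms, associators, unitors and braidings (the flips $v\otimes w\mapsto w\otimes v$ of $\mathbf V_{\underline x}\otimes \mathbf W_{\underline x}$, respectively from the summand $\mathbf V_{\underline x'}\otimes\mathbf W_{\underline x''}$ of $\mathbf V\boxtimes\mathbf W$ to the summand $\mathbf W_{\underline x''}\otimes\mathbf V_{\underline x'}$ of $\mathbf W\boxtimes\mathbf V$), are two symmetric monoidal structures on $\mathcal{VB}(\mathrm{UConf}(M))$, and the following are morphisms of this category: * $\mu:\mathbf I_\otimes\boxtimes\mathbf I_\otimes\to\mathbf I_\otimes$, given by the multiplications $\mathbb K_{\underline x'}\otimes\mathbb K_{\underline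 x''}\to\mathbb K_{\underline x'\sqcup\underline x''}$; * $\Delta:\mathbf I_\boxtimes\to\mathbf I_\boxtimes\otimes\mathbf I_\boxtimes$, given by $1\mapsto 1\otimes 1$ over $\emptyset$ and zero elsewhere; * $\nu:\mathbf I_\boxtimes\to\mathbf I_\otimes$, the inclusion: the identity of $\mathbb K$ over $\emptyset$, and zero elsewhere; * $sh:(\mathbf V'\otimes\mathbf W')\boxtimes(\mathbf V''\otimes\mathbf W'')\to(\mathbf V'\boxtimes\mathbf V'')\otimes(\mathbf W'\boxtimes\mathbf W'')$, the fibrewise injective map that sends $(v'\otimes w')\otimes(v''\otimes w'')$ in the summand of $\underline x=\underline x'\sqcup\underline x''$ to $(v'\otimes v'')\otimes(w'\otimes w'')$ in the tensor product of the two summands of the same split, i.e. the inclusion $$\bigoplus_{\underline x'\sqcup\underline x''=\underline x}\mathbf V'_{\underline x'}\otimes\mathbf W'_{\underline x'}\otimes\mathbf V''_{\underline x''}\otimes\mathbf W''_{\underline x''}\hookrightarrow\bigoplus_{\underline x'\sqcup\underline x''=\underline x=\underline{\tilde x}'\sqcup\underline{\tilde x}''}\mathbf V'_{\underline x'}\otimes\mathbf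 V''_{\underline x''}\otimes\mathbf W'_{\underline{\tilde x}'}\otimes\mathbf W''_{\underline{\tilde x}''}.$$ With these data $\mathcal{VB}(\mathrm{UConf}(M))$ is a symmetric $2$-monoidal category, that is: $sh$ is natural; it is compatible with the associators of $\boxtimes$ and of $\otimes$, with the unitors of $\boxtimes$ (through $\Delta$) and of $\otimes$ (through $\mu$), and with both braidings; $(\mathbf I_\otimes,\mu,\nu)$ is a commutative monoid for $\boxtimes$; and $(\mathbf I_\boxtimes,\Delta,\nu)$ is a cocommutative comonoid for $\otimes$. -/

import Mathlib

open CategoryTheory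
open scoped Manifold ContDiff TensorProduct DirectSum

universe v u

/-! ### Symmetric 2-monoidal categories -/

/-- The data and the axioms of a symmetric monoidal structure on the category `C`, whose tensor
product of objects is the given operation `T` and whose unit object is the given object `e`. -/
structure SymmetricMonoidalOn (C : Type u) [Category.{v} C] (T : C → C → C) (e : C) where
  /-- the tensor product of morphisms -/
  map : ∀ {X X' Y Y' : C}, (X ⟶ X') → (Y ⟶ Y') → (T X Y ⟶ T X' Y')
  /-- the associator -/
  assoc : ∀ X Y Z : C, T (T X Y) Z ≅ T X (T Y Z)
  /-- the left unitor -/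
  leftUnitor : ∀ X : C, T e X ≅ X
  /-- the right unitor -/
  rightUnitor : ∀ X : C, T X e ≅ X
  /-- the braiding -/
  braiding : ∀ X Y : C, T X Y ≅ T Y X
  map_id : ∀ X Y : C, map (𝟙 X) (𝟙 Y) = 𝟙 (T X Y)
  map_comp : ∀ {X X' X'' Y Y' Y'' : C} (f : X ⟶ X') (f' : X' ⟶ X'') (g : Y ⟶ Y') (g' : Y' ⟶ Y''),
    map (f ≫ f') (g ≫ g') = map f g ≫ map f' g'
  assoc_naturality : ∀ {X X' Y Y' Z Z' : C} (f : X ⟶ X') (g : Y ⟶ Y') (h : Z ⟶ Z'),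
    map (map f g) h ≫ (assoc X' Y' Z').hom = (assoc X Y Z).hom ≫ map f (map g h)
  leftUnitor_naturality : ∀ {X X' : C} (f : X ⟶ X'),
    map (𝟙 e) f ≫ (leftUnitor X').hom = (leftUnitor X).hom ≫ f
  rightUnitor_naturality : ∀ {X X' : C} (f : X ⟶ X'),
    map f (𝟙 e) ≫ (rightUnitor X').hom = (rightUnitor X).hom ≫ f
  braiding_naturality : ∀ {X X' Y Y' : C} (f : X ⟶ X') (g : Y ⟶ Y'),
    map f g ≫ (braiding X' Y').hom = (braiding X Y).hom ≫ map g f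
  pentagon : ∀ W X Y Z : C,
    map (assoc W X Y).hom (𝟙 Z) ≫ (assoc W (T X Y) Z).hom ≫ map (𝟙 W) (assoc X Y Z).hom =
      (assoc (T W X) Y Z).hom ≫ (assoc W X (T Y Z)).hom
  triangle : ∀ X Y : C,
    (assoc X e Y).hom ≫ map (𝟙 X) (leftUnitor Y).hom = map (rightUnitor X).hom (𝟙 Y)
  hexagon : ∀ X Y Z : C,
    (assoc X Y Z).hom ≫ (braiding X (T Y Z)).hom ≫ (assoc Y Z X).hom =
      map (braiding X Y).hom (𝟙 Z) ≫ (assoc Y X Z).hom ≫ map (𝟙 Y) (braiding X Z).hom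
  symmetry : ∀ X Y : C, (braiding X Y).hom ≫ (braiding Y X).hom = 𝟙 (T X Y)

namespace SymmetricMonoidalOn

variable {C : Type u} [Category.{v} C] {T : C → C → C} {e : C}

/-- The underlying monoidal category in the sense of Mathlib. -/
@[reducible] def toMonoidalCategory (S : SymmetricMonoidalOn C T e) : MonoidalCategory C :=
  letI : MonoidalCategoryStruct C :=
    { tensorObj := T
      tensorUnit := e
      whiskerLeft := fun X _ _ f => S.map (𝟙 X) f
      whiskerRight := fun f Y => S.map f (𝟙 Y)
      tensorHom := fun f g => S.map f g
      associator := S.assoc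
      leftUnitor := S.leftUnitor
      rightUnitor := S.rightUnitor }
  MonoidalCategory.ofTensorHom
    (id_tensorHom_id := S.map_id)
    (id_tensorHom := fun _ _ _ _ => rfl)
    (tensorHom_id := fun _ _ => rfl)
    (tensorHom_comp_tensorHom := fun f₁ f₂ g₁ g₂ => (S.map_comp f₁ g₁ f₂ g₂).symm)
    (associator_naturality := S.assoc_naturality)
    (leftUnitor_naturality := S.leftUnitor_naturality)
    (rightUnitor_naturality := S.rightUnitor_naturality)
    (pentagon := S.pentagon)
    (triangle := S.triangle)

/-- The underlying symmetric monoidal category in the sense of Mathlib. -/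
@[reducible] def toSymmetricCategory (S : SymmetricMonoidalOn C T e) :
    @SymmetricCategory C _ S.toMonoidalCategory :=
  letI := S.toMonoidalCategory
  { braiding := S.braiding
    braiding_naturality_right := fun X _ _ f => S.braiding_naturality (𝟙 X) f
    braiding_naturality_left := fun f Z => S.braiding_naturality f (𝟙 Z)
    hexagon_forward := S.hexagon
    hexagon_reverse := fun X Y Z => by
      have h1 : ∀ X Y Z : C, S.map (𝟙 X) (S.braiding Y Z).hom ≫ S.map (𝟙 X) (S.braiding Z Y).hom =
          𝟙 _ := fun X Y Z => by
        rw [← S.map_comp, S.symmetry, Category.comp_id, S.map_id]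
      have h2 : ∀ X Y Z : C, S.map (S.braiding X Y).hom (𝟙 Z) ≫ S.map (S.braiding Y X).hom (𝟙 Z) =
          𝟙 _ := fun X Y Z => by
        rw [← S.map_comp, S.symmetry, Category.comp_id, S.map_id]
      have h := S.hexagon Z X Y
      change (S.assoc X Y Z).inv ≫ (S.braiding (T X Y) Z).hom ≫ (S.assoc Z X Y).inv =
        S.map (𝟙 X) (S.braiding Y Z).hom ≫ (S.assoc X Z Y).inv ≫ S.map (S.braiding X Z).hom (𝟙 Y)
      have h3 := congrArg (fun t => S.map (𝟙 X) (S.braiding Y Z).hom ≫ (S.assoc X Z Y).inv ≫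
        S.map (S.braiding X Z).hom (𝟙 Y) ≫ t ≫ (S.assoc X Y Z).inv ≫
        (S.braiding (T X Y) Z).hom ≫ (S.assoc Z X Y).inv) h
      have e1 : S.map (S.braiding X Z).hom (𝟙 Y) ≫ S.map (S.braiding Z X).hom (𝟙 Y) = 𝟙 _ := h2 _ _ _
      have e2 := h1 X Y Z
      have e3 := S.symmetry Z (T X Y)
      simp only [Category.assoc, Iso.hom_inv_id_assoc, reassoc_of% e3, reassoc_of% e1,
        reassoc_of% e2, Iso.hom_inv_id, Category.comp_id, Iso.inv_hom_id_assoc] at h3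
      exact h3.symm
    symmetry := S.symmetry }

end SymmetricMonoidalOn

/-- The data and the axioms of a symmetric 2-monoidal category on `C` (a 2-monoidal category both of
whose monoidal structures are symmetric, with braidings compatible with the shuffle map), whose
tensor products of objects `T`, `P` and unit objects `I`, `J` are the given ones. The shuffle map
goes from `T` of `P`'s to `P` of `T`'s. -/
structure SymmetricTwoMonoidalOn (C : Type u) [Category.{v} C] (T : C → C → C) (I : C)
    (P : C → C → C) (J : C) where
  /-- the first symmetric monoidal structure, with product `T` and unit `I` -/
  fst : SymmetricMonoidalOn C T I
  /-- the second symmetric monoidal structure, with product `P` and unit `J` -/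
  snd : SymmetricMonoidalOn C P J
  /-- the shuffle map (interchange law) -/
  sh : ∀ A B A' B' : C, T (P A B) (P A' B') ⟶ P (T A A') (T B B')
  /-- the multiplication of `J` -/
  μ : T J J ⟶ J
  /-- the comultiplication of `I` -/
  Δ : I ⟶ P I I
  /-- the unit of `J`, which is also the counit of `I` -/
  ν : I ⟶ J
  sh_naturality : ∀ {A₁ A₂ B₁ B₂ A₁' A₂' B₁' B₂' : C} (a : A₁ ⟶ A₂) (b : B₁ ⟶ B₂)
    (a' : A₁' ⟶ A₂') (b' : B₁' ⟶ B₂'),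
    fst.map (snd.map a b) (snd.map a' b') ≫ sh A₂ B₂ A₂' B₂' =
      sh A₁ B₁ A₁' B₁' ≫ snd.map (fst.map a a') (fst.map b b')
  -- the shuffle map is associative with respect to both products
  sh_assoc_fst : ∀ A B A' B' A'' B'' : C,
    fst.map (sh A B A' B') (𝟙 (P A'' B'')) ≫ sh (T A A') (T B B') A'' B'' ≫
        snd.map (fst.assoc A A' A'').hom (fst.assoc B B' B'').hom =
      (fst.assoc (P A B) (P A' B') (P A'' B'')).hom ≫
        fst.map (𝟙 (P A B)) (sh A' B' A'' B'') ≫ sh A B (T A' A'') (T B' B'')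
  sh_assoc_snd : ∀ A B D A' B' D' : C,
    sh (P A B) D (P A' B') D' ≫ snd.map (sh A B A' B') (𝟙 (T D D')) ≫
        (snd.assoc (T A A') (T B B') (T D D')).hom =
      fst.map (snd.assoc A B D).hom (snd.assoc A' B' D').hom ≫
        sh A (P B D) A' (P B' D') ≫ snd.map (𝟙 (T A A')) (sh B D B' D')
  -- the shuffle map is unital with respect to both products
  sh_leftUnitor_fst : ∀ A B : C,
    fst.map Δ (𝟙 (P A B)) ≫ sh I I A B ≫ snd.map (fst.leftUnitor A).hom (fst.leftUnitor B).hom =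
      (fst.leftUnitor (P A B)).hom
  sh_rightUnitor_fst : ∀ A B : C,
    fst.map (𝟙 (P A B)) Δ ≫ sh A B I I ≫ snd.map (fst.rightUnitor A).hom (fst.rightUnitor B).hom =
      (fst.rightUnitor (P A B)).hom
  sh_leftUnitor_snd : ∀ A A' : C,
    sh J A J A' ≫ snd.map μ (𝟙 (T A A')) ≫ (snd.leftUnitor (T A A')).hom =
      fst.map (snd.leftUnitor A).hom (snd.leftUnitor A').hom
  sh_rightUnitor_snd : ∀ A A' : C,
    sh A J A' J ≫ snd.map (𝟙 (T A A')) μ ≫ (snd.rightUnitor (T A A')).hom =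
      fst.map (snd.rightUnitor A).hom (snd.rightUnitor A').hom
  -- `(J, μ, ν)` is a commutative monoid for the first monoidal structure
  μ_assoc : fst.map μ (𝟙 J) ≫ μ = (fst.assoc J J J).hom ≫ fst.map (𝟙 J) μ ≫ μ
  ν_μ : fst.map ν (𝟙 J) ≫ μ = (fst.leftUnitor J).hom
  μ_ν : fst.map (𝟙 J) ν ≫ μ = (fst.rightUnitor J).hom
  μ_comm : (fst.braiding J J).hom ≫ μ = μ
  -- `(I, Δ, ν)` is a cocommutative comonoid for the second monoidal structure
  Δ_assoc : Δ ≫ snd.map Δ (𝟙 I) ≫ (snd.assoc I I I).hom = Δ ≫ snd.map (𝟙 I) Δ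
  Δ_ν_left : Δ ≫ snd.map ν (𝟙 I) ≫ (snd.leftUnitor I).hom = 𝟙 I
  Δ_ν_right : Δ ≫ snd.map (𝟙 I) ν ≫ (snd.rightUnitor I).hom = 𝟙 I
  Δ_comm : Δ ≫ (snd.braiding I I).hom = Δ
  -- the shuffle map is compatible with both braidings
  sh_braiding_fst : ∀ A B A' B' : C,
    sh A B A' B' ≫ snd.map (fst.braiding A A').hom (fst.braiding B B').hom =
      (fst.braiding (P A B) (P A' B')).hom ≫ sh A' B' A B
  sh_braiding_snd : ∀ A B A' B' : C,
    sh A B A' B' ≫ (snd.braiding (T A A') (T B B')).hom =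
      fst.map (snd.braiding A B).hom (snd.braiding A' B').hom ≫ sh B A B' A'

noncomputable section

/-! ### The unordered configuration space -/

/-- The unordered configuration space of `M`, as a set: a configuration is a finite subset of `M`. -/
abbrev UConf (M : Type u) : Type u := Finset M

/-- The configuration `{z i | i}` of points of a finite tuple `z`. On tuples of `k` distinct points
this is the quotient map `q_k` from ordered to unordered configurations. -/
def conf {M : Type u} {ι : Type*} [Finite ι] (z : ι → M) : UConf M := (Set.finite_range z).toFinset

theorem mem_conf {M : Type u} {ι : Type*} [Finite ι] {z : ι → M} {p : M} :
    p ∈ conf z ↔ ∃ i, z i = p := by simp [conf]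

theorem conf_comp_equiv {M : Type u} {ι κ : Type*} [Finite ι] [Finite κ] (e : ι ≃ κ) (z : κ → M) :
    conf (z ∘ e) = conf z := by
  ext p; simp only [mem_conf, Function.comp]
  exact e.exists_congr_left.trans (by simp)

/-- The ordered `k`-point configurations, an open subspace of `M ^ k` when `M` is Hausdorff. -/
abbrev OConf (M : Type u) (k : ℕ) : Type u := {z : Fin k → M // Function.Injective z}

/-- The topology of `UConf M`: the disjoint union over `k` of the quotients of `OConf M k` by the
symmetric groups, that is, the quotient topology of the disjoint union of the `OConf M k`. -/
instance UConf.topology (M : Type u) [TopologicalSpace M] : TopologicalSpace (UConf M) :=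
  TopologicalSpace.coinduced (fun z : Σ k, OConf M k => conf z.2.1) inferInstance

theorem UConf.isOpen_iff {M : Type u} [TopologicalSpace M] {U : Set (UConf M)} :
    IsOpen U ↔ ∀ k, IsOpen {z : OConf M k | conf z.1 ∈ U} := by
  rw [isOpen_coinduced, isOpen_sigma_iff]; rfl

section
variable (E : Type*) [NormedAddCommGroup E] [NormedSpace ℝ E] {M : Type u} [TopologicalSpace M]
  [ChartedSpace E M] {F : Type*} [NormedAddCommGroup F] [NormedSpace ℝ F]

/-- Smoothness at the configuration `x` of a function `f` that is defined near `x` on `UConf M`, for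
the quotient smooth structure: as `q_k` is a local diffeomorphism from the open subset `OConf M k`
of the product manifold `M ^ k`, this says that the pullback of `f` along `q_k` is smooth at every
ordered configuration `z` above `x`. (All tuples near `z` have distinct entries.) -/
def SmoothAt (f : UConf M → F) (x : UConf M) : Prop :=
  ∀ (k : ℕ) (z : OConf M k), conf z.1 = x →
    ContMDiffAt (ModelWithCorners.pi fun _ : Fin k => 𝓘(ℝ, E)) 𝓘(ℝ, F) ∞
      (fun w : Fin k → M => f (conf w)) z.1

variable {E}

theorem isOpen_injective [T2Space M] (ι : Type*) [Finite ι] : IsOpen {z : ι → M | Function.Injective z} := by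
  have : {z : ι → M | Function.Injective z} = ⋂ (i : ι) (j : ι) (_ : i ≠ j), {z | z i ≠ z j} := by
    ext z; simp [Function.Injective, not_imp_not]
  rw [this]
  refine isOpen_iInter_of_finite fun i => isOpen_iInter_of_finite fun j =>
    isOpen_iInter_of_finite fun _ => ?_
  exact isOpen_ne_fun (continuous_apply i) (continuous_apply j)

theorem continuousAt_conf [T2Space M] {ι : Type*} [Finite ι] {z : ι → M} (hz : Function.Injective z) :
    ContinuousAt (conf : (ι → M) → UConf M) z := by
  obtain ⟨k, ⟨e⟩⟩ := Finite.exists_equiv_fin ι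
  intro N hN
  obtain ⟨O, hON, hO, hzO⟩ := mem_nhds_iff.1 hN
  have h1 := UConf.isOpen_iff.1 hO k
  have h2 : IsOpen ((fun w : ι → M => w ∘ e.symm) ⁻¹' (Subtype.val '' {z : OConf M k | conf z.1 ∈ O})) :=
    ((isOpen_injective (Fin k)).isOpenMap_subtype_val _ h1).preimage
      (continuous_pi fun i => continuous_apply _)
  rw [Filter.mem_map]
  refine Filter.mem_of_superset (h2.mem_nhds ?_) ?_
  · exact ⟨⟨z ∘ e.symm, hz.comp e.symm.injective⟩, by
      change conf (z ∘ e.symm) ∈ O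
      rw [conf_comp_equiv]; exact hzO, rfl⟩
  · rintro w ⟨y, hy, hyw⟩
    apply hON
    have : conf y.1 = conf w := by rw [hyw]; exact conf_comp_equiv e.symm w
    rw [← this]; exact hy

theorem SmoothAt.congr [T2Space M] {f g : UConf M → F} {x : UConf M} (hf : SmoothAt E f x)
    (h : f =ᶠ[nhds x] g) : SmoothAt E g x := by
  intro k z hz
  refine (hf k z hz).congr_of_eventuallyEq ?_
  have := (continuousAt_conf z.2).tendsto
  rw [hz] at this
  exact (this.eventually h).mono fun w hw => hw.symm

theorem smoothAt_const (c : F) (x : UConf M) : SmoothAt E (fun _ => c) x :=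
  fun _ _ _ => contMDiffAt_const

theorem SmoothAt.sum {ι : Type*} {s : Finset ι} {f : ι → UConf M → F} {x : UConf M}
    (h : ∀ i ∈ s, SmoothAt E (f i) x) : SmoothAt E (fun y => ∑ i ∈ s, f i y) x :=
  fun k z hz => ContMDiffAt.sum fun i hi => h i hi k z hz

theorem SmoothAt.mul {A : Type*} [NormedCommRing A] [NormedAlgebra ℝ A] {f g : UConf M → A} {x : UConf M}
    (hf : SmoothAt E f x) (hg : SmoothAt E g x) : SmoothAt E (fun y => f y * g y) x :=
  fun k z hz => by
    have hm : ContMDiff 𝓘(ℝ, A × A) 𝓘(ℝ, A) ∞ (fun p : A × A => p.1 * p.2) :=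
      (contDiff_mul (𝕜 := ℝ) (𝔸 := A)).contMDiff
    exact hm.contMDiffAt.comp z.1 ((hf k z hz).prodMk_space (hg k z hz))

theorem contMDiffAt_reindex {k l : ℕ} (θ : Fin l → Fin k) (z : Fin k → M) :
    ContMDiffAt (ModelWithCorners.pi fun _ : Fin k => 𝓘(ℝ, E))
      (ModelWithCorners.pi fun _ : Fin l => 𝓘(ℝ, E)) ∞ (fun w : Fin k → M => w ∘ θ) z := by
  rw [contMDiffAt_iff]
  refine ⟨(continuous_pi fun i => continuous_apply (θ i)).continuousAt, ?_⟩
  have key : ContDiff ℝ ∞ (fun u : Fin k → E => u ∘ θ) := by fun_prop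
  refine key.contDiffWithinAt.congr_of_eventuallyEq ?_ ?_
  · have hU : ∀ᶠ u in nhdsWithin (extChartAt (ModelWithCorners.pi fun _ : Fin k => 𝓘(ℝ, E)) z z)
        (Set.range (ModelWithCorners.pi fun _ : Fin k => 𝓘(ℝ, E))),
        u ∈ (extChartAt (ModelWithCorners.pi fun _ : Fin k => 𝓘(ℝ, E)) z).target :=
      extChartAt_target_mem_nhdsWithin z
    filter_upwards [hU] with u hu
    funext i
    have hu' : u (θ i) ∈ (chartAt E (z (θ i))).target := hu.2 (θ i) (Set.mem_univ _)
    exact (chartAt E (z (θ i))).right_inv hu'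
  · funext i
    exact (chartAt E (z (θ i))).right_inv ((chartAt E (z (θ i))).map_source (mem_chart_source _ _))

end

section bundles
variable (𝕜 : Type) [RCLike 𝕜] (E : Type*) [NormedAddCommGroup E] [NormedSpace ℝ E]
  (M : Type u) [TopologicalSpace M] [ChartedSpace E M]

/-! ### Vector bundles over the configuration space -/

/-- A local trivialisation of finite rank of a family `F` of vector spaces over `UConf M`: an open
set `base`, and over each of its points a basis (`frame`) of the fibre with its dual basis (`coord`),
that is, a linear isomorphism of the fibre with `ι → 𝕜`. The values of `frame` and `coord` outside of
`base` are irrelevant. -/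
structure LocalTriv {M : Type u} [TopologicalSpace M] (F : UConf M → Type u)
    [∀ x, AddCommGroup (F x)] [∀ x, Module 𝕜 (F x)] where
  base : Set (UConf M)
  isOpen_base : IsOpen base
  ι : Type
  [fintype : Fintype ι]
  [decEq : DecidableEq ι]
  frame : ι → ∀ x, F x
  coord : ι → ∀ x, F x →ₗ[𝕜] 𝕜
  coord_frame : ∀ x ∈ base, ∀ i j, coord i x (frame j x) = if i = j then 1 else 0
  sum_coord_frame : ∀ x ∈ base, ∀ v, ∑ i, coord i x v • frame i x = v

attribute [instance] LocalTriv.fintype LocalTriv.decEq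

/-- A smooth `𝕜`-vector bundle (of finite, locally constant rank) over `UConf M`: a family of vector
spaces with a vector bundle atlas, i.e. a set of local trivialisations that cover `UConf M` and whose
transition matrices are smooth. -/
structure VB where
  fiber : UConf M → Type u
  [addCommGroup : ∀ x, AddCommGroup (fiber x)]
  [module : ∀ x, Module 𝕜 (fiber x)]
  atlas : Set (LocalTriv 𝕜 fiber)
  exists_mem_base : ∀ x, ∃ e ∈ atlas, x ∈ e.base
  compat : ∀ e ∈ atlas, ∀ e' ∈ atlas, ∀ i j, ∀ x ∈ e.base ∩ e'.base,
    SmoothAt E (fun y => e'.coord j y (e.frame i y)) x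

attribute [instance] VB.addCommGroup VB.module

variable {𝕜 E M}

namespace VB

/-- A smooth bundle map over the identity of `UConf M`: a family of linear maps of the fibres whose
matrices in the local trivialisations are smooth. -/
@[ext]
structure Hom (V W : VB 𝕜 E M) where
  app : ∀ x, V.fiber x →ₗ[𝕜] W.fiber x
  smooth : ∀ e ∈ V.atlas, ∀ e' ∈ W.atlas, ∀ i j, ∀ x ∈ e.base ∩ e'.base,
    SmoothAt E (fun y => e'.coord j y (app y (e.frame i y))) x

instance [T2Space M] : Category (VB 𝕜 E M) where
  Hom := Hom
  id V := ⟨fun _ => LinearMap.id, V.compat⟩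
  comp {V W X} f g := ⟨fun x => g.app x ∘ₗ f.app x, by
    intro e he e' he' i j x hx
    obtain ⟨e'', he'', hx''⟩ := W.exists_mem_base x
    have h : SmoothAt E (fun y => ∑ k, e''.coord k y (f.app y (e.frame i y)) *
        e'.coord j y (g.app y (e''.frame k y))) x :=
      SmoothAt.sum fun k _ => (f.smooth e he e'' he'' i k x ⟨hx.1, hx''⟩).mul
        (g.smooth e'' he'' e' he' k j x ⟨hx'', hx.2⟩)
    refine h.congr ?_
    filter_upwards [e''.isOpen_base.mem_nhds hx''] with y hy
    conv_rhs => rw [LinearMap.comp_apply, ← e''.sum_coord_frame y hy (f.app y (e.frame i y))]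
    simp only [map_sum, map_smul, smul_eq_mul]⟩

/-! ### The Hadamard tensor product -/

theorem sum_smul_tmul {A B : Type*} [AddCommGroup A] [Module 𝕜 A] [AddCommGroup B] [Module 𝕜 B]
    {ι κ : Type*} [Fintype ι] [Fintype κ] (α : ι → 𝕜) (β : κ → 𝕜) (a : ι → A) (b : κ → B) :
    ∑ i : ι × κ, (α i.1 * β i.2) • (a i.1 ⊗ₜ[𝕜] b i.2) =
      (∑ i, α i • a i) ⊗ₜ[𝕜] (∑ j, β j • b j) := by
  rw [TensorProduct.sum_tmul, Fintype.sum_prod_type]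
  refine Finset.sum_congr rfl fun i _ => ?_
  rw [TensorProduct.tmul_sum]
  simp only [TensorProduct.smul_tmul_smul]

/-- The tensor product of two local trivialisations. -/
def hadamardTriv {V W : VB 𝕜 E M} (e : LocalTriv 𝕜 V.fiber) (f : LocalTriv 𝕜 W.fiber) :
    LocalTriv 𝕜 (fun x => V.fiber x ⊗[𝕜] W.fiber x) where
  base := e.base ∩ f.base
  isOpen_base := e.isOpen_base.inter f.isOpen_base
  ι := e.ι × f.ι
  frame i x := e.frame i.1 x ⊗ₜ f.frame i.2 x
  coord i x := LinearMap.mul' 𝕜 𝕜 ∘ₗ TensorProduct.map (e.coord i.1 x) (f.coord i.2 x)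
  coord_frame := by
    rintro x ⟨hx, hx'⟩ ⟨i, i'⟩ ⟨j, j'⟩
    simp [e.coord_frame x hx, f.coord_frame x hx', Prod.ext_iff, ← ite_and]
    try grind
  sum_coord_frame := by
    rintro x ⟨hx, hx'⟩ v
    induction v with
    | zero => simp
    | add v w hv hw => simp only [map_add, add_smul, Finset.sum_add_distrib, hv, hw]
    | tmul v w =>
      conv_rhs => rw [← e.sum_coord_frame x hx v, ← f.sum_coord_frame x hx' w]
      rw [← sum_smul_tmul]
      simp

/-- The Hadamard tensor product, with fibres `V_x ⊗ W_x`. -/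
def hadamard (V W : VB 𝕜 E M) : VB 𝕜 E M where
  fiber x := V.fiber x ⊗[𝕜] W.fiber x
  atlas := {t | ∃ e ∈ V.atlas, ∃ f ∈ W.atlas, t = hadamardTriv e f}
  exists_mem_base x := by
    obtain ⟨e, he, hx⟩ := V.exists_mem_base x
    obtain ⟨f, hf, hx'⟩ := W.exists_mem_base x
    exact ⟨_, ⟨e, he, f, hf, rfl⟩, hx, hx'⟩
  compat := by
    rintro _ ⟨e, he, f, hf, rfl⟩ _ ⟨e', he', f', hf', rfl⟩ i j x ⟨⟨h1, h2⟩, h3, h4⟩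
    exact (V.compat e he e' he' i.1 j.1 x ⟨h1, h3⟩).mul (W.compat f hf f' hf' i.2 j.2 x ⟨h2, h4⟩)

variable (𝕜 E M)

/-- The trivial line bundle, the unit of the Hadamard tensor product. -/
def hadamardUnit : VB 𝕜 E M where
  fiber _ := ULift.{u} 𝕜
  atlas := {{ base := Set.univ
              isOpen_base := isOpen_univ
              ι := Unit
              frame := fun _ _ => ⟨1⟩
              coord := fun _ _ => ULift.moduleEquiv.toLinearMap
              coord_frame := by simp
              sum_coord_frame := by intro x _ v; ext; simp }}
  exists_mem_base x := ⟨_, rfl, Set.mem_univ x⟩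
  compat := by
    rintro _ rfl _ rfl i j x -
    exact smoothAt_const _ _

theorem isOpen_vacuum : IsOpen ({∅} : Set (UConf M)) := by
  rw [UConf.isOpen_iff]
  intro k
  rcases k with _ | k
  · convert isOpen_univ
    ext z; simp [Finset.ext_iff, mem_conf]
  · convert isOpen_empty
    ext z; simp only [Set.mem_singleton_iff, Set.mem_ofPred_eq, Set.mem_empty_iff_false, iff_false]
    intro h
    have : z.1 0 ∈ conf z.1 := mem_conf.2 ⟨0, rfl⟩
    rw [h] at this
    simp at this

theorem isOpen_vacuum_compl : IsOpen ({∅}ᶜ : Set (UConf M)) := by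
  rw [UConf.isOpen_iff]
  intro k
  rcases k with _ | k
  · convert isOpen_empty
    ext z; simp [Finset.ext_iff, mem_conf]
  · convert isOpen_univ
    ext z; simp only [Set.mem_compl_iff, Set.mem_singleton_iff, Set.mem_ofPred_eq, Set.mem_univ, iff_true]
    intro h
    have : z.1 0 ∈ conf z.1 := mem_conf.2 ⟨0, rfl⟩
    rw [h] at this
    simp at this

/-- The fibre at `x` of the Cauchy unit: the whole of `𝕜` if `x` is empty, and zero otherwise. -/
def vacuumFiber {M : Type u} (x : UConf M) : Submodule 𝕜 (ULift.{u} 𝕜) where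
  carrier := {c | x ≠ ∅ → c = 0}
  add_mem' := by
    intro a b ha hb hx; rw [ha hx, hb hx, add_zero]
  zero_mem' := fun _ => rfl
  smul_mem' := by
    intro c a ha hx; rw [ha hx, smul_zero]

/-- The unit of the Cauchy tensor product: `𝕜` over the empty configuration and zero elsewhere. -/
def cauchyUnit [T2Space M] : VB 𝕜 E M where
  fiber x := vacuumFiber 𝕜 x
  atlas := {{ base := {∅}
              isOpen_base := isOpen_vacuum M
              ι := Unit
              frame := fun _ x => ⟨⟨open Classical in if x = ∅ then 1 else 0⟩, fun hx => by simp [hx]; rfl⟩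
              coord := fun _ _ => ULift.moduleEquiv.toLinearMap ∘ₗ Submodule.subtype _
              coord_frame := by
                rintro x rfl i j; simp
              sum_coord_frame := by rintro x rfl v; ext; simp },
            { base := {∅}ᶜ
              isOpen_base := isOpen_vacuum_compl M
              ι := Empty
              frame := fun i => i.elim
              coord := fun i => i.elim
              coord_frame := fun _ _ i => i.elim
              sum_coord_frame := by
                rintro x hx v; exact Subtype.ext (v.2 hx).symm }}
  exists_mem_base x := by
    by_cases hx : x = ∅
    · exact ⟨_, Or.inl rfl, hx⟩
    · exact ⟨_, Or.inr rfl, hx⟩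
  compat := by
    rintro _ (rfl | rfl) _ (rfl | rfl) i j x hx
    · refine (smoothAt_const 1 x).congr ?_
      filter_upwards [(isOpen_vacuum M).mem_nhds hx.1] with y hy
      obtain rfl : y = ∅ := hy
      simp
    · exact j.elim
    · exact i.elim
    · exact i.elim

end VB

/-! ### The Cauchy tensor product -/

/-- The configuration `x` is the disjoint union of the configurations `a` and `b`. -/
def IsSplit {M : Type u} (a b x : UConf M) : Prop := Disjoint a b ∧ ∀ p, p ∈ x ↔ p ∈ a ∨ p ∈ b

/-- The ordered splits of `x` into two disjoint configurations. -/
@[ext]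
structure Split {M : Type u} (x : UConf M) where
  left : UConf M
  right : UConf M
  isSplit : IsSplit left right x

instance {M : Type u} (x : UConf M) : DecidableEq (Split x) := Classical.decEq _

theorem IsSplit.right_unique {M : Type u} {a b b' x : UConf M} (h : IsSplit a b x)
    (h' : IsSplit a b' x) : b = b' := by
  ext p
  have h1 := h.2 p
  have h2 := h'.2 p
  have h3 : p ∈ a → p ∉ b := fun ha hb => Finset.disjoint_left.1 h.1 ha hb
  have h4 : p ∈ a → p ∉ b' := fun ha hb => Finset.disjoint_left.1 h'.1 ha hb
  tauto

theorem exists_equiv_of_conf_eq {M : Type u} {ι κ : Type*} [Finite ι] [Finite κ] {z : ι → M} {z' : κ → M}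
    (hz : Function.Injective z) (hz' : Function.Injective z') (h : conf z' = conf z) :
    ∃ σ : κ ≃ ι, z' = z ∘ σ := by
  have hr : Set.range z' = Set.range z := by
    ext p; simpa [mem_conf] using Finset.ext_iff.1 h p
  refine ⟨(Equiv.ofInjective z' hz').trans ((Equiv.setCongr hr).trans (Equiv.ofInjective z hz).symm), ?_⟩
  funext i
  have := Equiv.apply_ofInjective_symm hz (Equiv.setCongr hr (Equiv.ofInjective z' hz' i))
  simpa using this.symm

theorem isOpen_image_conf {k : ℕ} {N : Set (Fin k → M)} (hN : IsOpen N) :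
    IsOpen (conf '' {w | w ∈ N ∧ Function.Injective w} : Set (UConf M)) := by
  rw [UConf.isOpen_iff]
  intro l
  have : {z : OConf M l | conf z.1 ∈ (conf '' {w | w ∈ N ∧ Function.Injective w} : Set (UConf M))} =
      ⋃ σ : Fin k ≃ Fin l, (fun z : OConf M l => z.1 ∘ σ) ⁻¹' N := by
    ext z
    simp only [Set.mem_ofPred_eq, Set.mem_image, Set.mem_iUnion, Set.mem_preimage]
    constructor
    · rintro ⟨w, ⟨hw, hwi⟩, h⟩
      obtain ⟨σ, hσ⟩ := exists_equiv_of_conf_eq z.2 hwi h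
      exact ⟨σ, hσ ▸ hw⟩
    · rintro ⟨σ, hσ⟩
      exact ⟨z.1 ∘ σ, ⟨hσ, z.2.comp σ.injective⟩, conf_comp_equiv σ z.1⟩
  rw [this]
  exact isOpen_iUnion fun σ => hN.preimage (continuous_pi fun i =>
    (continuous_apply (σ i)).comp continuous_subtype_val)

theorem eventually_nhds_conf [T2Space M] {k : ℕ} {z : Fin k → M} (hz : Function.Injective z) {P : UConf M → Prop}
    (h : ∀ᶠ w in nhds z, P (conf w)) : ∀ᶠ y in nhds (conf z), P y := by
  obtain ⟨N, hNP, hN, hzN⟩ := mem_nhds_iff.1 h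
  refine Filter.mem_of_superset ((isOpen_image_conf hN).mem_nhds ⟨z, ⟨hzN, hz⟩, rfl⟩) ?_
  rintro _ ⟨w, ⟨hw, -⟩, rfl⟩
  exact hNP hw

namespace VB

/-- The fibre at `x` of the Cauchy tensor product: the direct sum of `V_a ⊗ W_b` over all ordered
splits of `x` into `a` and `b`. -/
abbrev cauchyFiber (V W : VB 𝕜 E M) (x : UConf M) : Type u :=
  ⨁ s : Split x, V.fiber s.left ⊗[𝕜] W.fiber s.right

/-- The element `v ⊗ w` of the summand of the split of `x` into `a` and `b`. -/
def cauchyTmul {V W : VB 𝕜 E M} {a b x : UConf M} (h : IsSplit a b x) (v : V.fiber a)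
    (w : W.fiber b) : cauchyFiber V W x :=
  DirectSum.lof 𝕜 (Split x) (fun s => V.fiber s.left ⊗[𝕜] W.fiber s.right) ⟨a, b, h⟩ (v ⊗ₜ w)

open Classical in
/-- The functional `φ ⊗ ψ` on the summands `V_a ⊗ W_b` with first part `a`, zero on the others. -/
def cauchyCoord {V W : VB 𝕜 E M} (φ : ∀ x, V.fiber x →ₗ[𝕜] 𝕜) (ψ : ∀ x, W.fiber x →ₗ[𝕜] 𝕜)
    (a x : UConf M) : cauchyFiber V W x →ₗ[𝕜] 𝕜 :=
  DirectSum.toModule 𝕜 (Split x) 𝕜 fun s =>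
    if s.left = a then LinearMap.mul' 𝕜 𝕜 ∘ₗ TensorProduct.map (φ s.left) (ψ s.right) else 0

open Classical in
theorem cauchyCoord_tmul {V W : VB 𝕜 E M} (φ : ∀ x, V.fiber x →ₗ[𝕜] 𝕜)
    (ψ : ∀ x, W.fiber x →ₗ[𝕜] 𝕜) (a : UConf M) {a' b' x : UConf M} (h : IsSplit a' b' x)
    (v : V.fiber a') (w : W.fiber b') :
    cauchyCoord φ ψ a x (cauchyTmul h v w) = if a' = a then φ a' v * ψ b' w else 0 := by
  rw [cauchyCoord, cauchyTmul, DirectSum.toModule_lof]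
  dsimp only
  split_ifs with h1
  · simp
  · simp

/-- The data for a local trivialisation of the Cauchy tensor product near a `k`-point configuration:
disjoint open sets `U 1, …, U k` of `M` and, for each set `S` of indices, trivialisations of `V` and
`W` from their atlases over the image under `q` of the product of the `U i` with `i` in `S`. -/
structure CauchyChart (V W : VB 𝕜 E M) where
  k : ℕ
  U : Fin k → Set M
  isOpen_U : ∀ i, IsOpen (U i)
  disjoint_U : ∀ i j, i ≠ j → Disjoint (U i) (U j)
  e : Finset (Fin k) → LocalTriv 𝕜 V.fiber
  f : Finset (Fin k) → LocalTriv 𝕜 W.fiber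
  e_mem : ∀ S, e S ∈ V.atlas
  f_mem : ∀ S, f S ∈ W.atlas
  e_base : ∀ S, ∀ z : Fin k → M, (∀ i, z i ∈ U i) → conf (fun i : S => z i) ∈ (e S).base
  f_base : ∀ S, ∀ z : Fin k → M, (∀ i, z i ∈ U i) → conf (fun i : S => z i) ∈ (f S).base

namespace CauchyChart
variable {V W : VB 𝕜 E M} (c : CauchyChart V W)

/-- The open set `q (U 1 × … × U k)` of the configuration space. -/
def box : Set (UConf M) := {x | ∃ z : Fin c.k → M, (∀ i, z i ∈ c.U i) ∧ conf z = x}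

open Classical in
/-- The points of the configuration `x` that lie in some `U i` with `i` in `S`. -/
def part (S : Finset (Fin c.k)) (x : UConf M) : UConf M := x.filter fun p => ∃ i ∈ S, p ∈ c.U i

theorem eq_of_mem {p : M} {i j : Fin c.k} (hi : p ∈ c.U i) (hj : p ∈ c.U j) : i = j := by
  by_contra h
  exact Set.disjoint_left.1 (c.disjoint_U i j h) hi hj

theorem injective {z : Fin c.k → M} (hz : ∀ i, z i ∈ c.U i) : Function.Injective z :=
  fun i j h => c.eq_of_mem (hz i) (h ▸ hz j)

theorem part_conf (S : Finset (Fin c.k)) {z : Fin c.k → M} (hz : ∀ i, z i ∈ c.U i) :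
    c.part S (conf z) = conf (fun i : S => z i) := by
  ext p
  simp only [part, Finset.mem_filter, mem_conf]
  constructor
  · rintro ⟨⟨i, rfl⟩, j, hj, hij⟩
    obtain rfl := c.eq_of_mem (hz i) hij
    exact ⟨⟨i, hj⟩, rfl⟩
  · rintro ⟨i, rfl⟩
    exact ⟨⟨i, rfl⟩, i, i.2, hz i⟩

theorem isSplit_part (S : Finset (Fin c.k)) {x : UConf M} (hx : x ∈ c.box) :
    IsSplit (c.part S x) (c.part Sᶜ x) x := by
  obtain ⟨z, hz, rfl⟩ := hx
  rw [part_conf c S hz, part_conf c Sᶜ hz]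
  refine ⟨Finset.disjoint_left.2 fun p hp hp' => ?_, fun p => ?_⟩
  · obtain ⟨i, rfl⟩ := mem_conf.1 hp
    obtain ⟨j, hj⟩ := mem_conf.1 hp'
    exact Finset.mem_compl.1 j.2 (c.injective hz hj ▸ i.2)
  · simp only [mem_conf]
    constructor
    · rintro ⟨i, rfl⟩
      by_cases hi : i ∈ S
      · exact Or.inl ⟨⟨i, hi⟩, rfl⟩
      · exact Or.inr ⟨⟨i, Finset.mem_compl.2 hi⟩, rfl⟩
    · rintro (⟨i, rfl⟩ | ⟨i, rfl⟩) <;> exact ⟨i, rfl⟩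

theorem part_injective {S S' : Finset (Fin c.k)} {x : UConf M} (hx : x ∈ c.box)
    (h : c.part S x = c.part S' x) : S = S' := by
  obtain ⟨z, hz, rfl⟩ := hx
  rw [part_conf c S hz, part_conf c S' hz] at h
  ext i
  have := Finset.ext_iff.1 h (z i)
  simpa [mem_conf, (c.injective hz).eq_iff] using this

theorem exists_part {a b x : UConf M} (hx : x ∈ c.box) (h : IsSplit a b x) :
    ∃ S, c.part S x = a ∧ c.part Sᶜ x = b := by
  classical
  have hS : ∃ S, c.part S x = a := by
    obtain ⟨z, hz, rfl⟩ := hx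
    refine ⟨Finset.univ.filter fun i => z i ∈ a, ?_⟩
    rw [part_conf c _ hz]
    ext p
    simp only [mem_conf]
    constructor
    · rintro ⟨i, rfl⟩; exact (Finset.mem_filter.1 i.2).2
    · intro hp
      obtain ⟨i, rfl⟩ := mem_conf.1 ((h.2 p).2 (Or.inl hp))
      exact ⟨⟨i, by simpa using hp⟩, rfl⟩
  obtain ⟨S, rfl⟩ := hS
  exact ⟨S, rfl, (c.isSplit_part S hx).right_unique h⟩

theorem part_mem_e {S : Finset (Fin c.k)} {x : UConf M} (hx : x ∈ c.box) :
    c.part S x ∈ (c.e S).base := by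
  obtain ⟨z, hz, rfl⟩ := hx
  rw [part_conf c S hz]; exact c.e_base S z hz

theorem part_mem_f {S : Finset (Fin c.k)} {x : UConf M} (hx : x ∈ c.box) :
    c.part S x ∈ (c.f S).base := by
  obtain ⟨z, hz, rfl⟩ := hx
  rw [part_conf c S hz]; exact c.f_base S z hz

theorem isOpen_pi : IsOpen {z : Fin c.k → M | ∀ i, z i ∈ c.U i} := by
  have := isOpen_set_pi (Set.finite_univ (α := Fin c.k)) fun i _ => c.isOpen_U i
  simpa [Set.pi] using this

theorem isOpen_box : IsOpen c.box := by
  convert isOpen_image_conf c.isOpen_pi using 1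
  ext x
  constructor
  · rintro ⟨z, hz, rfl⟩; exact ⟨z, ⟨hz, c.injective hz⟩, rfl⟩
  · rintro ⟨z, ⟨hz, -⟩, rfl⟩; exact ⟨z, hz, rfl⟩

theorem smoothAt_part [T2Space M] {F : Type*} [NormedAddCommGroup F] [NormedSpace ℝ F]
    {T : UConf M → F} {S : Finset (Fin c.k)} {x : UConf M} (hx : x ∈ c.box)
    (hT : SmoothAt E T (c.part S x)) : SmoothAt E (fun y => T (c.part S y)) x := by
  obtain ⟨z, hz, rfl⟩ := hx
  rintro l ⟨z', hz'⟩ h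
  obtain ⟨σ, rfl⟩ := exists_equiv_of_conf_eq (c.injective hz) hz' h
  let s := S.equivFin
  let θ : Fin S.card → Fin l := fun i => σ.symm (s.symm i)
  have hpart : ∀ w : Fin l → M, (∀ i, w (σ.symm i) ∈ c.U i) → c.part S (conf w) = conf (w ∘ θ) := by
    intro w hw
    rw [← conf_comp_equiv σ.symm w, c.part_conf S (z := w ∘ σ.symm) hw]
    exact (conf_comp_equiv s.symm (fun i : S => w (σ.symm i))).symm
  have hz2 : ∀ i, (z ∘ σ) (σ.symm i) ∈ c.U i := fun i => by simpa using hz i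
  have h1 := hT _ ⟨(z ∘ σ) ∘ θ, hz'.comp (σ.symm.injective.comp
    (Subtype.val_injective.comp s.symm.injective))⟩ (by rw [← h]; exact (hpart _ hz2).symm)
  have h2 := ContMDiffAt.comp (z ∘ σ) h1 (contMDiffAt_reindex (E := E) θ (z ∘ σ))
  refine h2.congr_of_eventuallyEq ?_
  have h3 : IsOpen {w : Fin l → M | ∀ i, w (σ.symm i) ∈ c.U i} :=
    c.isOpen_pi.preimage (f := fun w : Fin l → M => w ∘ σ.symm)
      (continuous_pi fun i => continuous_apply (σ.symm i))
  filter_upwards [h3.mem_nhds hz2] with w hw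
  exact congrArg T (hpart w hw)

theorem eventually_part_eq_iff [T2Space M] (c' : CauchyChart V W) (S : Finset (Fin c.k))
    (S' : Finset (Fin c'.k)) {x : UConf M} (hx : x ∈ c.box) (hx' : x ∈ c'.box) :
    ∀ᶠ y in nhds x, (c.part S y = c'.part S' y ↔ c.part S x = c'.part S' x) := by
  obtain ⟨z, hz, rfl⟩ := hx
  obtain ⟨z', hz', h⟩ := hx'
  obtain ⟨σ, rfl⟩ := exists_equiv_of_conf_eq (c.injective hz) (c'.injective hz') h
  have key : ∀ w : Fin c.k → M, (∀ i, w i ∈ c.U i) → (∀ i, (w ∘ σ) i ∈ c'.U i) →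
      (c.part S (conf w) = c'.part S' (conf w) ↔ S = S'.map σ.toEmbedding) := by
    intro w hw hw'
    rw [c.part_conf S hw, ← conf_comp_equiv σ w, c'.part_conf S' hw']
    rw [Finset.ext_iff, Finset.ext_iff]
    constructor
    · intro H i
      have := H (w i)
      simpa [mem_conf, (c.injective hw).eq_iff, Finset.mem_map, -Finset.mem_map_equiv] using this
    · intro H p
      simp only [mem_conf, Subtype.exists, Function.comp]
      constructor
      · rintro ⟨i, hi, rfl⟩
        obtain ⟨j, hj, rfl⟩ := Finset.mem_map.1 ((H i).1 hi)
        exact ⟨j, hj, rfl⟩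
      · rintro ⟨j, hj, rfl⟩
        exact ⟨σ j, (H _).2 (Finset.mem_map.2 ⟨j, hj, rfl⟩), rfl⟩
  apply eventually_nhds_conf (c.injective hz)
  have h3 : IsOpen {w : Fin c.k → M | ∀ i, (w ∘ σ) i ∈ c'.U i} :=
    c'.isOpen_pi.preimage (f := fun w : Fin c.k → M => w ∘ σ)
      (continuous_pi fun i => continuous_apply (σ i))
  filter_upwards [c.isOpen_pi.mem_nhds hz, h3.mem_nhds hz'] with w hw hw'
  rw [key w hw hw', key z hz hz']

open Classical in
/-- The local trivialisation of the Cauchy tensor product over `q (U 1 × … × U k)` whose frame consists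
of the tensors of the frames of `V` and `W` at complementary parts of the configuration. -/
def triv : LocalTriv 𝕜 (cauchyFiber V W) where
  base := c.box
  isOpen_base := c.isOpen_box
  ι := Σ S : Finset (Fin c.k), (c.e S).ι × (c.f Sᶜ).ι
  frame i x :=
    if h : IsSplit (c.part i.1 x) (c.part i.1ᶜ x) x then
      cauchyTmul h ((c.e i.1).frame i.2.1 _) ((c.f i.1ᶜ).frame i.2.2 _)
    else 0
  coord i x := cauchyCoord ((c.e i.1).coord i.2.1) ((c.f i.1ᶜ).coord i.2.2) (c.part i.1 x) x
  coord_frame := by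
    rintro x hx ⟨S, a, b⟩ ⟨S', a', b'⟩
    rw [dif_pos (c.isSplit_part S' hx), cauchyCoord_tmul]
    dsimp only
    by_cases h : S = S'
    · subst h
      rw [(c.e S).coord_frame _ (c.part_mem_e hx), (c.f Sᶜ).coord_frame _ (c.part_mem_f hx)]
      simp [Prod.ext_iff, ← ite_and]
      try grind
    · rw [if_neg fun h' => h (c.part_injective hx h').symm, if_neg fun h' => h (congrArg Sigma.fst h')]
  sum_coord_frame := by
    intro x hx v
    induction v using DirectSum.induction_on with
    | zero => simp
    | add v w hv hw => simp only [map_add, add_smul, Finset.sum_add_distrib, hv, hw]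
    | of s t =>
      obtain ⟨a, b, hs⟩ := s
      obtain ⟨S, rfl, rfl⟩ := c.exists_part hx hs
      induction t with
      | zero => simp
      | add v w hv hw => simp only [map_add, add_smul, Finset.sum_add_distrib, hv, hw]
      | tmul v w =>
        change ∑ i : Σ S : Finset (Fin c.k), (c.e S).ι × (c.f Sᶜ).ι,
          cauchyCoord _ _ _ x (cauchyTmul hs v w) • _ = cauchyTmul hs v w
        rw [Fintype.sum_sigma, Finset.sum_eq_single S]
        · conv_rhs =>
            rw [cauchyTmul, ← (c.e S).sum_coord_frame _ (c.part_mem_e hx) v,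
              ← (c.f Sᶜ).sum_coord_frame _ (c.part_mem_f hx) w, ← sum_smul_tmul, map_sum]
          refine Finset.sum_congr rfl fun i _ => ?_
          rw [cauchyCoord_tmul, if_pos rfl, dif_pos (c.isSplit_part S hx), map_smul]
          rfl
        · intro S' _ hS'
          refine Finset.sum_eq_zero fun i _ => ?_
          rw [cauchyCoord_tmul, if_neg fun h => hS' (c.part_injective hx h).symm, zero_smul]
        · simp

end CauchyChart

/-- The Cauchy tensor product of vector bundles over `UConf M`. -/
def cauchy [T2Space M] (V W : VB 𝕜 E M) : VB 𝕜 E M where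
  fiber := cauchyFiber V W
  atlas := Set.range CauchyChart.triv
  exists_mem_base x := by
    let z : Fin x.card → M := fun i => (x.equivFin.symm i : M)
    have hz : Function.Injective z := Subtype.val_injective.comp x.equivFin.symm.injective
    have hzx : conf z = x := by
      ext p
      rw [mem_conf]
      exact ⟨fun ⟨i, hi⟩ => hi ▸ (x.equivFin.symm i).2,
        fun hp => ⟨x.equivFin ⟨p, hp⟩, by simp [z]⟩⟩
    choose eV hV hxV using V.exists_mem_base
    choose eW hW hxW using W.exists_mem_base
    have hev : ∀ᶠ w in nhds z, ∀ S : Finset (Fin x.card),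
        conf (fun i : S => w i) ∈ (eV (conf fun i : S => z i)).base ∩
          (eW (conf fun i : S => z i)).base := by
      refine Filter.eventually_all.2 fun S => ?_
      have h1 : ContinuousAt (fun w : Fin x.card → M => (conf (fun i : S => w i) : UConf M)) z :=
        ContinuousAt.comp (f := fun (w : Fin x.card → M) (i : S) => w i)
          (continuousAt_conf (z := fun i : S => z i) (hz.comp Subtype.val_injective))
          (continuous_pi fun i => continuous_apply _).continuousAt
      exact h1.eventually (((eV _).isOpen_base.inter (eW _).isOpen_base).mem_nhds
        ⟨hxV _, hxW _⟩)
    obtain ⟨N, hNP, hN, hzN⟩ := mem_nhds_iff.1 hev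
    obtain ⟨u, hu, huN⟩ := isOpen_pi_iff'.1 hN z hzN
    obtain ⟨O, hO, hdis⟩ := (Set.finite_range z).t2_separation
    let c : CauchyChart V W :=
      { k := x.card
        U := fun i => O (z i) ∩ u i
        isOpen_U := fun i => (hO _).2.inter (hu i).1
        disjoint_U := fun i j hij => (hdis ⟨i, rfl⟩ ⟨j, rfl⟩ (hz.ne hij)).mono
          Set.inter_subset_left Set.inter_subset_left
        e := fun S => eV (conf fun i : S => z i)
        f := fun S => eW (conf fun i : S => z i)
        e_mem := fun S => hV _
        f_mem := fun S => hW _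
        e_base := fun S w hw => (hNP (huN fun i _ => (hw i).2) S).1
        f_base := fun S w hw => (hNP (huN fun i _ => (hw i).2) S).2 }
    exact ⟨c.triv, ⟨c, rfl⟩, z, fun i => ⟨(hO _).1, (hu i).2⟩, hzx⟩
  compat := by
    classical
    rintro _ ⟨c, rfl⟩ _ ⟨c', rfl⟩ ⟨S, a, b⟩ ⟨S', a', b'⟩ x ⟨hx, hx'⟩
    have heq : ∀ᶠ y in nhds x, (if c.part S y = c'.part S' y then
        (c'.e S').coord a' (c.part S y) ((c.e S).frame a (c.part S y)) *
        (c'.f S'ᶜ).coord b' (c.part Sᶜ y) ((c.f Sᶜ).frame b (c.part Sᶜ y)) else 0) =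
        (c'.triv.coord ⟨S', a', b'⟩ y) (c.triv.frame ⟨S, a, b⟩ y) := by
      filter_upwards [c.isOpen_box.mem_nhds hx] with y hy
      simp only [CauchyChart.triv]
      rw [dif_pos (c.isSplit_part S hy), cauchyCoord_tmul]
    refine SmoothAt.congr ?_ heq
    have hev := c.eventually_part_eq_iff c' S S' hx hx'
    by_cases h : c.part S x = c'.part S' x
    · have h2 : c.part Sᶜ x = c'.part S'ᶜ x :=
        (c.isSplit_part S hx).right_unique (h ▸ c'.isSplit_part S' hx')
      have g1 := c.smoothAt_part (S := S) hx (V.compat _ (c.e_mem S) _ (c'.e_mem S') a a' _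
        ⟨c.part_mem_e hx, h ▸ c'.part_mem_e hx'⟩)
      have g2 := c.smoothAt_part (S := Sᶜ) hx (W.compat _ (c.f_mem Sᶜ) _ (c'.f_mem S'ᶜ) b b' _
        ⟨c.part_mem_f hx, h2 ▸ c'.part_mem_f hx'⟩)
      refine (g1.mul g2).congr ?_
      filter_upwards [hev] with y hy
      rw [if_pos (hy.2 h)]
    · refine (smoothAt_const 0 x).congr ?_
      filter_upwards [hev] with y hy
      rw [if_neg fun h' => h (hy.1 h')]

/-! ### Generators of the fibres -/

/-- The linear map on fibres given by a bundle map. -/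
abbrev onFiber [T2Space M] {V W : VB 𝕜 E M} (f : V ⟶ W) (x : UConf M) :
    V.fiber x →ₗ[𝕜] W.fiber x :=
  Hom.app f x

/-- The pure tensor `v ⊗ w` in the fibre of the Hadamard tensor product. -/
def tmulH {V W : VB 𝕜 E M} {x : UConf M} (v : V.fiber x) (w : W.fiber x) :
    (hadamard V W).fiber x :=
  v ⊗ₜ[𝕜] w

/-- The pure tensor `v ⊗ w` in the summand `V_a ⊗ W_b` of the fibre at `x = a ⊔ b` of the Cauchy
tensor product. -/
def tmulC [T2Space M] {V W : VB 𝕜 E M} {a b x : UConf M} (h : IsSplit a b x) (v : V.fiber a)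
    (w : W.fiber b) : (cauchy V W).fiber x :=
  cauchyTmul h v w

variable (𝕜 E) in
/-- The element `1` of the fibre `𝕜` at `x` of the Hadamard unit. -/
def oneH (x : UConf M) : (hadamardUnit 𝕜 E M).fiber x :=
  ULift.up 1

variable (𝕜 E M) in
/-- The element `1` of the fibre `𝕜` at the empty configuration of the Cauchy unit. -/
def oneC [T2Space M] : (cauchyUnit 𝕜 E M).fiber ∅ :=
  ⟨ULift.up 1, fun h => (h rfl).elim⟩

end VB

end bundles

end

/-! Every structure map is a family of linear maps of fibres given by a formula on pure tensors. Two
things need proof: these families are smooth, and the diagrams commute.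

The diagrams reduce to pure tensors. Iterated pure tensors span the fibres of iterated products
(`Generates.hadamard`, `Generates.cauchy`), and bundle maps that agree on spanning sets are equal
(`Generates.hom_ext`). What remains is to compare splits of one configuration, and there the second
part of a split is determined by the first (`IsSplit.right_unique`).

Smoothness is tested on local frames (`homOfFrames`). A frame of the Cauchy product consists of
sections `y ↦ v (y ∩ A) ⊗ w (y ∩ B)` with `A`, `B` disjoint open sets that cover the configuration
(`IsFrameSec.of_cauchy`). Conversely, every section of this form with smooth `v` and `w` is smooth
(`SmoothSec.box`). This rests on two facts. The map `y ↦ y ∩ A` lifts locally to a projection of `M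
^ k` onto some of its factors, so it preserves smoothness (`SmoothAt.comp_res`). Whether two such
pairs of open sets cut a configuration in the same way is locally constant
(`Separates.eventually_res_eq_iff`). From then on charts of the Cauchy product play no role: each
structure map takes tensors of smooth sections to tensors of smooth sections.

The shuffle map is injective because its components at equal splits are, summand by summand, the
isomorphism that interchanges the two middle tensor factors (`projHC_comp_shuffle`). -/

set_option linter.unusedSectionVars false

/-! ### Separating open sets -/

section separation

variable {M : Type u}

open Classical in
/-- The part of the configuration `y` that lies in the set `A`. -/
noncomputable def res (A : Set M) (y : UConf M) : UConf M := y.filter (· ∈ A)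

@[simp] theorem mem_res {A : Set M} {y : UConf M} {p : M} : p ∈ res A y ↔ p ∈ y ∧ p ∈ A := by
  simp [res]

theorem res_res (A B : Set M) (y : UConf M) : res A (res B y) = res (B ∩ A) y := by
  ext p; simp [and_assoc]

namespace IsSplit

variable {a b c d x : UConf M}

theorem symm (h : IsSplit a b x) : IsSplit b a x :=
  ⟨h.1.symm, fun p => by rw [h.2 p, or_comm]⟩

theorem empty_left (x : UConf M) : IsSplit ∅ x x := ⟨by simp, by simp⟩

theorem eq_of_left (h : IsSplit ∅ b x) : b = x := h.right_unique (empty_left x)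

/-- If `x = (a ⊔ b) ⊔ c` then `x = a ⊔ (b ⊔ c)`: the first of the two splits. -/
theorem assoc_left (h₁ : IsSplit d c x) (h₂ : IsSplit a b d) : IsSplit a (res (↑a)ᶜ x) x := by
  refine ⟨Finset.disjoint_left.2 fun p hp hp' => (mem_res.1 hp').2 hp, fun p => ?_⟩
  have := h₁.2 p
  have := h₂.2 p
  simp only [mem_res, Set.mem_compl_iff, Finset.mem_coe]
  tauto

/-- If `x = (a ⊔ b) ⊔ c` then `x = a ⊔ (b ⊔ c)`: the second of the two splits. -/
theorem assoc_right (h₁ : IsSplit d c x) (h₂ : IsSplit a b d) : IsSplit b c (res (↑a)ᶜ x) := by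
  refine ⟨Finset.disjoint_left.2 fun p hp hp' =>
    Finset.disjoint_left.1 h₁.1 ((h₂.2 p).2 (Or.inr hp)) hp', fun p => ?_⟩
  have := h₁.2 p
  have := h₂.2 p
  have h3 : p ∈ d → p ∉ c := fun ha hb => Finset.disjoint_left.1 h₁.1 ha hb
  have h4 : p ∈ a → p ∉ b := fun ha hb => Finset.disjoint_left.1 h₂.1 ha hb
  simp only [mem_res, Set.mem_compl_iff, Finset.mem_coe]
  tauto

end IsSplit

variable [TopologicalSpace M]

/-- `A` and `B` are disjoint open sets whose union contains the configuration `x`. -/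
structure Separates (A B : Set M) (x : UConf M) : Prop where
  isOpen_left : IsOpen A
  isOpen_right : IsOpen B
  disjoint : Disjoint A B
  subset : ∀ p ∈ x, p ∈ A ∨ p ∈ B

/-- These sets and those of `UConf.isOpen_exists_mem` supply the neighbourhoods for separations:
pulled back to ordered configurations, they are finite intersections and finite unions of open
conditions on single coordinates. -/
theorem UConf.isOpen_forall_mem {O : Set M} (hO : IsOpen O) :
    IsOpen {y : UConf M | ∀ p ∈ y, p ∈ O} := by
  rw [UConf.isOpen_iff]
  intro k
  have : {z : OConf M k | conf z.1 ∈ {y : UConf M | ∀ p ∈ y, p ∈ O}} =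
      ⋂ i : Fin k, {z : OConf M k | z.1 i ∈ O} := by
    ext z; simp [mem_conf]
  rw [this]
  exact isOpen_iInter_of_finite fun i =>
    hO.preimage ((continuous_apply i).comp continuous_subtype_val)

theorem UConf.isOpen_exists_mem {O : Set M} (hO : IsOpen O) :
    IsOpen {y : UConf M | ∃ p ∈ y, p ∈ O} := by
  rw [UConf.isOpen_iff]
  intro k
  have : {z : OConf M k | conf z.1 ∈ {y : UConf M | ∃ p ∈ y, p ∈ O}} =
      ⋃ i : Fin k, {z : OConf M k | z.1 i ∈ O} := by
    ext z; simp [mem_conf]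
  rw [this]
  exact isOpen_iUnion fun i => hO.preimage ((continuous_apply i).comp continuous_subtype_val)

namespace Separates

variable {A B A' B' : Set M} {x : UConf M}

theorem symm (h : Separates A B x) : Separates B A x :=
  ⟨h.2, h.1, h.3.symm, fun p hp => (h.4 p hp).symm⟩

theorem not_mem (h : Separates A B x) {p : M} (hp : p ∈ A) : p ∉ B :=
  Set.disjoint_left.1 h.disjoint hp

theorem eventually (h : Separates A B x) : ∀ᶠ y in nhds x, Separates A B y := by
  filter_upwards [(UConf.isOpen_forall_mem (h.1.union h.2)).mem_nhds h.4] with y hy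
  exact ⟨h.1, h.2, h.3, hy⟩

theorem isSplit (h : Separates A B x) : IsSplit (res A x) (res B x) x := by
  refine ⟨Finset.disjoint_left.2 fun p hp hp' => ?_, fun p => ?_⟩
  · exact h.not_mem (mem_res.1 hp).2 (mem_res.1 hp').2
  · have := h.subset p
    simp only [mem_res]
    tauto

/-- Reassociation at the level of open sets: the three regions `A ∩ A'`, `A ∩ B'`, `B` are regrouped
with the last two together. This and the next two lemmas serve the smoothness of the Cauchy
associator. -/
theorem of_isSplit (h : Separates A B x) (h' : Separates A' B' (res A x)) :
    Separates (A ∩ A') (A ∩ B' ∪ B) x := by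
  refine ⟨h.1.inter h'.1, (h.1.inter h'.2).union h.2, ?_, fun p hp => ?_⟩
  · refine Set.disjoint_left.2 fun p hp hp' => ?_
    rcases hp' with hp' | hp'
    · exact h'.not_mem hp.2 hp'.2
    · exact h.not_mem hp.1 hp'
  · have h1 := h.subset p hp
    have h2 := h'.subset p
    simp only [mem_res, Set.mem_inter_iff, Set.mem_union] at *
    tauto

/-- The inner separation is given only over `x`. At another configuration `y` it is recovered from
the regrouped one, since a point of `A` is not in `B` and so must lie in `A'` or `B'`. -/
theorem left_of_assoc (h : Separates A B x) (h1 : Separates A' B' (res A x)) {y : UConf M}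
    (h2 : Separates (A ∩ A') (A ∩ B' ∪ B) y) : Separates A' B' (res A y) := by
  refine ⟨h1.1, h1.2, h1.3, fun p hp => ?_⟩
  have h3 := h2.subset p
  have h4 : p ∈ A → p ∉ B := h.not_mem
  simp only [mem_res, Set.mem_inter_iff, Set.mem_union] at *
  tauto

theorem right_of_assoc (h : Separates A B x) (h' : Separates A' B' (res A x)) :
    Separates (A ∩ B') B (res (A ∩ B' ∪ B) x) := by
  refine ⟨h.1.inter h'.2, h.2, h.3.mono_left Set.inter_subset_left, fun p hp => ?_⟩
  exact (mem_res.1 hp).2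

/-- This turns equality of parts into an open condition on the points. Its negation, given the two
separations, says that some point lies in `A ∩ B'` or `B ∩ A'`, which is open as well; hence the
local constancy below. -/
theorem res_eq_res_iff (h : Separates A B x) (h' : Separates A' B' x) :
    res A x = res A' x ↔ ∀ p ∈ x, p ∈ A ∩ A' ∪ B ∩ B' := by
  rw [Finset.ext_iff]
  refine forall_congr' fun p => ?_
  have h1 := h.subset p
  have h2 := h'.subset p
  have h3 : p ∈ A → p ∉ B := h.not_mem
  have h4 : p ∈ A' → p ∉ B' := h'.not_mem
  simp only [mem_res, Set.mem_inter_iff, Set.mem_union]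
  tauto

theorem eventually_res_eq_iff (h : Separates A B x) (h' : Separates A' B' x) :
    ∀ᶠ y in nhds x, (res A y = res A' y ↔ res A x = res A' x) := by
  by_cases hx : res A x = res A' x
  · filter_upwards [h.eventually, h'.eventually,
      (UConf.isOpen_forall_mem ((h.1.inter h'.1).union (h.2.inter h'.2))).mem_nhds
        ((h.res_eq_res_iff h').1 hx)] with y hy hy' hyy
    exact iff_of_true ((hy.res_eq_res_iff hy').2 hyy) hx
  · have hx' : ∃ p ∈ x, p ∈ A ∩ B' ∪ B ∩ A' := by
      rw [h.res_eq_res_iff h'] at hx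
      push Not at hx
      obtain ⟨p, hp, hpx⟩ := hx
      refine ⟨p, hp, ?_⟩
      have h1 := h.subset p hp
      have h2 := h'.subset p hp
      simp only [Set.mem_inter_iff, Set.mem_union] at *
      tauto
    filter_upwards [h.eventually, h'.eventually,
      (UConf.isOpen_exists_mem ((h.1.inter h'.2).union (h.2.inter h'.1))).mem_nhds hx']
      with y hy hy' hyy
    refine iff_of_false (fun hyx => ?_) hx
    obtain ⟨p, hp, hpy⟩ := hyy
    have h1 := (hy.res_eq_res_iff hy').1 hyx p hp
    have h3 : p ∈ A → p ∉ B := h.not_mem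
    have h4 : p ∈ A' → p ∉ B' := h'.not_mem
    simp only [Set.mem_inter_iff, Set.mem_union] at *
    tauto

end Separates

/-- On ordered configurations near `z`, restriction to `A` forgets a fixed set of coordinates, and
such a projection of `M ^ l` is smooth. -/
theorem SmoothAt.comp_res {E : Type*} [NormedAddCommGroup E] [NormedSpace ℝ E] [ChartedSpace E M]
    {F : Type*} [NormedAddCommGroup F] [NormedSpace ℝ F] {A B : Set M} {x : UConf M}
    (h : Separates A B x) {T : UConf M → F} (hT : SmoothAt E T (res A x)) :
    SmoothAt E (fun y => T (res A y)) x := by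
  classical
  rintro l ⟨z, hz⟩ rfl
  let S : Finset (Fin l) := Finset.univ.filter fun i => z i ∈ A
  let θ : Fin S.card → Fin l := fun i => S.equivFin.symm i
  have hθ : Function.Injective θ := Subtype.val_injective.comp S.equivFin.symm.injective
  have hθr : ∀ i, i ∈ S ↔ ∃ j, θ j = i := fun i =>
    ⟨fun hi => ⟨S.equivFin ⟨i, hi⟩, by simp [θ]⟩, by rintro ⟨j, rfl⟩; exact (S.equivFin.symm j).2⟩
  -- On this neighbourhood of `z` each point stays on the side where `z` has it, so the indices of
  -- the points in `A` do not vary.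
  let N : Set (Fin l → M) := {w | ∀ i, (i ∈ S → w i ∈ A) ∧ (i ∉ S → w i ∈ B)}
  have hN : IsOpen N := by
    have : N = ⋂ i, {w | (i ∈ S → w i ∈ A) ∧ (i ∉ S → w i ∈ B)} := by ext w; simp [N]
    rw [this]
    refine isOpen_iInter_of_finite fun i => ?_
    by_cases hi : i ∈ S
    · simp only [hi, true_imp_iff, not_true_eq_false, false_imp_iff, and_true]
      exact h.1.preimage (continuous_apply i)
    · simp only [hi, not_false_eq_true, true_imp_iff, false_imp_iff, true_and]
      exact h.2.preimage (continuous_apply i)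
  have hzN : z ∈ N := fun i => by
    have := h.subset (z i) (mem_conf.2 ⟨i, rfl⟩)
    simp only [S, Finset.mem_filter, Finset.mem_univ, true_and]
    tauto
  have hres : ∀ w ∈ N, res A (conf w) = conf (w ∘ θ) := by
    intro w hw
    ext p
    simp only [mem_res, mem_conf, Function.comp]
    constructor
    · rintro ⟨⟨i, rfl⟩, hi⟩
      have hiS : i ∈ S := by
        by_contra hiS
        exact h.not_mem hi ((hw i).2 hiS)
      obtain ⟨j, rfl⟩ := (hθr i).1 hiS
      exact ⟨j, rfl⟩
    · rintro ⟨j, rfl⟩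
      exact ⟨⟨_, rfl⟩, (hw _).1 ((hθr _).2 ⟨j, rfl⟩)⟩
  have h1 := hT _ ⟨z ∘ θ, hz.comp hθ⟩ (hres z hzN).symm
  have h2 := ContMDiffAt.comp z h1 (contMDiffAt_reindex (E := E) θ z)
  refine h2.congr_of_eventuallyEq ?_
  filter_upwards [hN.mem_nhds hzN] with w hw
  exact congrArg T (hres w hw)

end separation

noncomputable section bundleMaps

variable {𝕜 : Type} [RCLike 𝕜] {E : Type v} [NormedAddCommGroup E] [NormedSpace ℝ E]
  {M : Type u} [TopologicalSpace M] [T2Space M] [ChartedSpace E M]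

namespace VB

variable {V W X Y V' W' X' Y' : VB 𝕜 E M}

/-! ### Smooth local sections -/

/-- The section `s` of `V` is smooth at `x`. -/
def SmoothSec (V : VB 𝕜 E M) (s : ∀ y, V.fiber y) (x : UConf M) : Prop :=
  ∀ e ∈ V.atlas, x ∈ e.base → ∀ j, SmoothAt E (fun y => e.coord j y (s y)) x

/-- The section `s` belongs to the frame of a local trivialisation at `x` from the atlas of `V`. -/
def IsFrameSec (V : VB 𝕜 E M) (s : ∀ y, V.fiber y) (x : UConf M) : Prop :=
  ∃ e ∈ V.atlas, x ∈ e.base ∧ ∃ i, s = e.frame i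

theorem IsFrameSec.smoothSec {s : ∀ y, V.fiber y} {x : UConf M} (h : IsFrameSec V s x) :
    SmoothSec V s x := by
  obtain ⟨e, he, hx, i, rfl⟩ := h
  exact fun e' he' hx' j => V.compat e he e' he' i j x ⟨hx, hx'⟩

theorem SmoothSec.congr {s t : ∀ y, V.fiber y} {x : UConf M} (h : SmoothSec V s x)
    (hst : ∀ᶠ y in nhds x, s y = t y) : SmoothSec V t x := fun e he hx j =>
  (h e he hx j).congr <| hst.mono fun y hy => by simp only [hy]

/-- In a local frame the coordinates of the image are the matrix of `f` applied to the coordinates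
of `s`: sums of products of smooth functions. -/
theorem SmoothSec.map (f : V ⟶ W) {s : ∀ y, V.fiber y} {x : UConf M} (h : SmoothSec V s x) :
    SmoothSec W (fun y => onFiber f y (s y)) x := by
  intro e' he' hx' j
  obtain ⟨e, he, hx⟩ := V.exists_mem_base x
  have h1 : SmoothAt E (fun y => ∑ k, e.coord k y (s y) *
      e'.coord j y (onFiber f y (e.frame k y))) x :=
    SmoothAt.sum fun k _ => (h e he hx k).mul (Hom.smooth f e he e' he' k j x ⟨hx, hx'⟩)
  refine h1.congr ?_
  filter_upwards [e.isOpen_base.mem_nhds hx] with y hy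
  conv_rhs => rw [← e.sum_coord_frame y hy (s y)]
  simp only [map_sum, map_smul, smul_eq_mul]

/-- A family of linear maps of the fibres is smooth if it sends frames to smooth sections. -/
def homOfFrames (φ : ∀ x, V.fiber x →ₗ[𝕜] W.fiber x)
    (h : ∀ x s, IsFrameSec V s x → SmoothSec W (fun y => φ y (s y)) x) : V ⟶ W :=
  Hom.mk φ fun e he e' he' i j x hx => h x _ ⟨e, he, hx.1, i, rfl⟩ e' he' hx.2 j

@[simp] theorem homOfFrames_app (φ : ∀ x, V.fiber x →ₗ[𝕜] W.fiber x)
    (h : ∀ x s, IsFrameSec V s x → SmoothSec W (fun y => φ y (s y)) x) (x : UConf M)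
    (v : V.fiber x) : onFiber (homOfFrames φ h) x v = φ x v := rfl

@[simp] theorem id_app (x : UConf M) (v : V.fiber x) : onFiber (𝟙 V) x v = v := rfl

@[simp] theorem comp_app (f : V ⟶ W) (g : W ⟶ X) (x : UConf M) (v : V.fiber x) :
    onFiber (f ≫ g) x v = onFiber g x (onFiber f x v) := rfl

/-! ### Generators -/

/-- The sets `G x` span the fibres of `V`. -/
def Generates (V : VB 𝕜 E M) (G : ∀ x, Set (V.fiber x)) : Prop :=
  ∀ x, Submodule.span 𝕜 (G x) = ⊤

theorem generates_univ (V : VB 𝕜 E M) : Generates V fun _ => Set.univ :=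
  fun _ => Submodule.span_univ

/-- All equations between bundle maps of iterated products below are checked through this lemma. The
sets `G x` may be chosen small, such as `{oneH 𝕜 E x}` for a unit, which makes the unitors
computable. -/
theorem Generates.hom_ext {G : ∀ x, Set (V.fiber x)} (hG : Generates V G) {f g : V ⟶ W}
    (h : ∀ x, ∀ v ∈ G x, onFiber f x v = onFiber g x v) : f = g :=
  Hom.ext (funext fun x => LinearMap.ext_on (hG x) fun v hv => h x v hv)

/-! ### The fibres of the Hadamard tensor product -/

/-- The pure tensors of elements of `G` and `H`. -/
def hadamardGens (G : ∀ x, Set (V.fiber x)) (H : ∀ x, Set (W.fiber x)) (x : UConf M) :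
    Set ((hadamard V W).fiber x) :=
  {t | ∃ v ∈ G x, ∃ w ∈ H x, t = tmulH v w}

theorem Generates.hadamard {G : ∀ x, Set (V.fiber x)} {H : ∀ x, Set (W.fiber x)}
    (hG : Generates V G) (hH : Generates W H) : Generates (hadamard V W) (hadamardGens G H) := by
  intro x
  have h : Submodule.span 𝕜 (Set.image2 (fun v w => TensorProduct.mk 𝕜 _ _ v w) (G x) (H x)) =
      (⊤ : Submodule 𝕜 (V.fiber x ⊗[𝕜] W.fiber x)) := by
    rw [← Submodule.map₂_span_span, hG x, hH x, TensorProduct.map₂_mk_top_top_eq_top]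
  rw [eq_top_iff]
  refine h.symm.le.trans (Submodule.span_mono ?_)
  rintro _ ⟨v, hv, w, hw, rfl⟩
  exact ⟨v, hv, w, hw, rfl⟩

/-- The linear map out of a fibre of the Hadamard tensor product given by a bilinear map. -/
def liftH {P : Type*} [AddCommGroup P] [Module 𝕜 P] {x : UConf M}
    (φ : V.fiber x →ₗ[𝕜] W.fiber x →ₗ[𝕜] P) : (hadamard V W).fiber x →ₗ[𝕜] P :=
  TensorProduct.lift φ

@[simp] theorem liftH_tmulH {P : Type*} [AddCommGroup P] [Module 𝕜 P] {x : UConf M}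
    (φ : V.fiber x →ₗ[𝕜] W.fiber x →ₗ[𝕜] P) (v : V.fiber x) (w : W.fiber x) :
    liftH φ (tmulH v w) = φ v w :=
  TensorProduct.lift.tmul v w

/-- The pure tensor in the Hadamard tensor product as a bilinear map. -/
def mkH (x : UConf M) : V.fiber x →ₗ[𝕜] W.fiber x →ₗ[𝕜] (hadamard V W).fiber x :=
  TensorProduct.mk 𝕜 _ _

@[simp] theorem mkH_apply {x : UConf M} (v : V.fiber x) (w : W.fiber x) :
    mkH x v w = tmulH v w := rfl

theorem SmoothSec.tmulH {s : ∀ y, V.fiber y} {t : ∀ y, W.fiber y} {x : UConf M}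
    (hs : SmoothSec V s x) (ht : SmoothSec W t x) :
    SmoothSec (hadamard V W) (fun y => VB.tmulH (s y) (t y)) x := by
  rintro _ ⟨e, he, f, hf, rfl⟩ ⟨hx, hx'⟩ ⟨i, j⟩
  exact (hs e he hx i).mul (ht f hf hx' j)

/-- Together with `SmoothSec.tmulH` this reduces smoothness of maps out of a Hadamard product to
tensors of sections. `IsFrameSec.of_cauchy` and `SmoothSec.box` play the same role for the Cauchy
product. -/
theorem IsFrameSec.of_hadamard {s : ∀ y, (hadamard V W).fiber y} {x : UConf M}
    (h : IsFrameSec (hadamard V W) s x) :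
    ∃ v w, IsFrameSec V v x ∧ IsFrameSec W w x ∧ s = fun y => tmulH (v y) (w y) := by
  obtain ⟨_, ⟨e, he, f, hf, rfl⟩, ⟨hx, hx'⟩, i, rfl⟩ := h
  exact ⟨e.frame i.1, f.frame i.2, ⟨e, he, hx, _, rfl⟩, ⟨f, hf, hx', _, rfl⟩, rfl⟩

/-! ### The fibres of the Cauchy tensor product -/

/-- The pure tensor in the Cauchy tensor product as a bilinear map. -/
def mkC {a b x : UConf M} (h : IsSplit a b x) :
    V.fiber a →ₗ[𝕜] W.fiber b →ₗ[𝕜] (cauchy V W).fiber x :=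
  (TensorProduct.mk 𝕜 _ _).compr₂
    (DirectSum.lof 𝕜 (Split x) (fun s => V.fiber s.left ⊗[𝕜] W.fiber s.right) ⟨a, b, h⟩)

@[simp] theorem mkC_apply {a b x : UConf M} (h : IsSplit a b x) (v : V.fiber a) (w : W.fiber b) :
    mkC h v w = tmulC h v w := rfl

/-- The linear map out of a fibre of the Cauchy tensor product given by bilinear maps. -/
def liftC {P : Type*} [AddCommGroup P] [Module 𝕜 P] {x : UConf M}
    (φ : ∀ a b, IsSplit a b x → V.fiber a →ₗ[𝕜] W.fiber b →ₗ[𝕜] P) :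
    (cauchy V W).fiber x →ₗ[𝕜] P :=
  DirectSum.toModule 𝕜 (Split x) P fun s => TensorProduct.lift (φ s.left s.right s.isSplit)

@[simp] theorem liftC_tmulC {P : Type*} [AddCommGroup P] [Module 𝕜 P] {x : UConf M}
    (φ : ∀ a b, IsSplit a b x → V.fiber a →ₗ[𝕜] W.fiber b →ₗ[𝕜] P) {a b : UConf M}
    (h : IsSplit a b x) (v : V.fiber a) (w : W.fiber b) :
    liftC φ (tmulC h v w) = φ a b h v w :=
  (DirectSum.toModule_lof 𝕜 (φ := fun s : Split x => TensorProduct.lift (φ s.left s.right s.isSplit))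
    ⟨a, b, h⟩ (v ⊗ₜ[𝕜] w)).trans
    (TensorProduct.lift.tmul v w)

/-- The pure tensors of elements of `G` and `H`. -/
def cauchyGens (G : ∀ x, Set (V.fiber x)) (H : ∀ x, Set (W.fiber x)) (x : UConf M) :
    Set ((cauchy V W).fiber x) :=
  {t | ∃ (a b : UConf M) (h : IsSplit a b x), ∃ v ∈ G a, ∃ w ∈ H b, t = tmulC h v w}

theorem tmulC_mem_span {G : ∀ x, Set (V.fiber x)} {H : ∀ x, Set (W.fiber x)}
    (hG : Generates V G) (hH : Generates W H) {a b x : UConf M} (h : IsSplit a b x)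
    (v : V.fiber a) (w : W.fiber b) :
    tmulC h v w ∈ Submodule.span 𝕜 (cauchyGens G H x) := by
  have h1 : mkC h v w ∈ Submodule.map₂ (mkC h) (Submodule.span 𝕜 (G a)) (Submodule.span 𝕜 (H b)) :=
    Submodule.apply_mem_map₂ _ (by rw [hG a]; trivial) (by rw [hH b]; trivial)
  rw [Submodule.map₂_span_span] at h1
  refine Submodule.span_mono ?_ h1
  rintro _ ⟨v, hv, w, hw, rfl⟩
  exact ⟨a, b, h, v, hv, w, hw, rfl⟩

theorem Generates.cauchy {G : ∀ x, Set (V.fiber x)} {H : ∀ x, Set (W.fiber x)}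
    (hG : Generates V G) (hH : Generates W H) : Generates (cauchy V W) (cauchyGens G H) := by
  refine fun x => Submodule.eq_top_iff'.2 fun t => ?_
  induction t using DirectSum.induction_on with
  | zero => exact zero_mem _
  | add v w hv hw => exact add_mem hv hw
  | of s t =>
    obtain ⟨a, b, h⟩ := s
    induction t with
    | zero => rw [map_zero]; exact zero_mem _
    | add v w hv hw => rw [map_add]; exact add_mem hv hw
    | tmul v w => exact tmulC_mem_span hG hH h v w

open Classical in
/-- The section of the Cauchy tensor product with value `v (y ∩ A) ⊗ w (y ∩ B)` at `y`. -/
def boxSec (A B : Set M) (v : ∀ y, V.fiber y) (w : ∀ y, W.fiber y) (y : UConf M) :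
    (VB.cauchy V W).fiber y :=
  if h : IsSplit (res A y) (res B y) y then tmulC h (v _) (w _) else 0

/-- The parts are variables with equations, so that values over equal but differently written
configurations can be compared without transport between fibres. -/
theorem boxSec_eq {A B : Set M} (v : ∀ y, V.fiber y) (w : ∀ y, W.fiber y) {a b y : UConf M}
    (h : IsSplit a b y) (ha : res A y = a) (hb : res B y = b) :
    boxSec A B v w y = tmulC h (v a) (w b) := by
  subst ha hb
  exact dif_pos h

theorem boxSec_eq_zero {A B : Set M} (v : ∀ y, V.fiber y) (w : ∀ y, W.fiber y) {y : UConf M}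
    (h : ¬IsSplit (res A y) (res B y) y) : boxSec A B v w y = 0 :=
  dif_neg h

/-- The bridge from charts to separations: the sets `U i` are merged into one open set for the
indices in `S` and one for the rest. -/
theorem separates_of_mem_box (c : CauchyChart V W) (S : Finset (Fin c.k)) {x : UConf M}
    (hx : x ∈ c.box) :
    Separates {p | ∃ i ∈ S, p ∈ c.U i} {p | ∃ i ∈ Sᶜ, p ∈ c.U i} x := by
  have ho : ∀ T : Finset (Fin c.k), IsOpen {p | ∃ i ∈ T, p ∈ c.U i} := fun T => by
    have : {p | ∃ i ∈ T, p ∈ c.U i} = ⋃ i ∈ T, c.U i := by ext p; simp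
    rw [this]
    exact isOpen_biUnion fun i _ => c.isOpen_U i
  refine ⟨ho _, ho _, Set.disjoint_left.2 ?_, ?_⟩
  · rintro p ⟨i, hi, hp⟩ ⟨j, hj, hp'⟩
    exact Finset.mem_compl.1 hj (c.eq_of_mem hp hp' ▸ hi)
  · obtain ⟨z, hz, rfl⟩ := hx
    intro p hp
    obtain ⟨i, rfl⟩ := mem_conf.1 hp
    by_cases hi : i ∈ S
    · exact Or.inl ⟨i, hi, hz i⟩
    · exact Or.inr ⟨i, Finset.mem_compl.2 hi, hz i⟩

theorem part_eq_res (c : CauchyChart V W) (S : Finset (Fin c.k)) (x : UConf M) :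
    c.part S x = res {p | ∃ i ∈ S, p ∈ c.U i} x := by
  ext p; simp [CauchyChart.part]

/-- In a Cauchy chart, a coordinate of the section is a product of coordinates of `v` and `w` where
the split by `A`, `B` agrees with the one of the chart, and zero elsewhere. Agreement is locally
constant, so near `x` only one of the two cases occurs. -/
theorem SmoothSec.box {A B : Set M} {v : ∀ y, V.fiber y} {w : ∀ y, W.fiber y} {x : UConf M}
    (h : Separates A B x) (hv : SmoothSec V v (res A x)) (hw : SmoothSec W w (res B x)) :
    SmoothSec (VB.cauchy V W) (boxSec A B v w) x := by
  classical
  rintro _ ⟨c, rfl⟩ hx ⟨S, i, j⟩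
  replace hx : x ∈ c.box := hx
  have hc := separates_of_mem_box c S hx
  -- The coordinate functional with index `S` sees only the summand whose first part is `c.part S
  -- y`.
  have heq : ∀ᶠ y in nhds x, (if res A y = c.part S y then
      (c.e S).coord i (res A y) (v (res A y)) * (c.f Sᶜ).coord j (res B y) (w (res B y)) else 0) =
      c.triv.coord ⟨S, i, j⟩ y (boxSec A B v w y) := by
    filter_upwards [h.eventually] with y hy
    rw [boxSec_eq v w hy.isSplit rfl rfl]
    exact (cauchyCoord_tmul _ _ _ hy.isSplit _ _).symm
  refine SmoothAt.congr ?_ heq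
  have hev := h.eventually_res_eq_iff hc
  simp only [← part_eq_res] at hev
  by_cases h1 : res A x = c.part S x
  · have h2 : res B x = c.part Sᶜ x :=
      h.isSplit.right_unique (h1 ▸ c.isSplit_part S hx)
    have g1 := (hv _ (c.e_mem S) (h1 ▸ c.part_mem_e hx) i).comp_res h
    have g2 := (hw _ (c.f_mem Sᶜ) (h2 ▸ c.part_mem_f hx) j).comp_res h.symm
    refine (g1.mul g2).congr ?_
    filter_upwards [hev] with y hy
    rw [if_pos (hy.2 h1)]
  · refine (smoothAt_const 0 x).congr ?_
    filter_upwards [hev] with y hy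
    rw [if_neg fun h' => h1 (hy.1 h')]

theorem IsFrameSec.of_cauchy {s : ∀ y, (VB.cauchy V W).fiber y} {x : UConf M}
    (h : IsFrameSec (VB.cauchy V W) s x) :
    ∃ A B v w, Separates A B x ∧ IsFrameSec V v (res A x) ∧ IsFrameSec W w (res B x) ∧
      s = boxSec A B v w := by
  obtain ⟨_, ⟨c, rfl⟩, hx, ⟨S, i, j⟩, rfl⟩ := h
  replace hx : x ∈ c.box := hx
  refine ⟨_, _, (c.e S).frame i, (c.f Sᶜ).frame j, separates_of_mem_box c S hx,
    ⟨_, c.e_mem S, part_eq_res c S x ▸ c.part_mem_e hx, i, rfl⟩,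
    ⟨_, c.f_mem Sᶜ, part_eq_res c Sᶜ x ▸ c.part_mem_f hx, j, rfl⟩, ?_⟩
  -- The two sections must agree at every `y`, also where the parts do not make up `y`; there both
  -- take the default value zero.
  funext y
  by_cases h : IsSplit (c.part S y) (c.part Sᶜ y) y
  · exact (dif_pos h).trans (boxSec_eq _ _ h (part_eq_res c S y).symm (part_eq_res c Sᶜ y).symm).symm
  · rw [part_eq_res, part_eq_res] at h
    exact (dif_neg (by rwa [part_eq_res, part_eq_res])).trans (boxSec_eq_zero _ _ h).symm

/-! ### The fibres of the units -/

theorem IsFrameSec.of_hadamardUnit {s : ∀ y, (hadamardUnit 𝕜 E M).fiber y} {x : UConf M}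
    (h : IsFrameSec (hadamardUnit 𝕜 E M) s x) : s = oneH 𝕜 E := by
  obtain ⟨_, rfl, hx, i, rfl⟩ := h
  rfl

theorem smoothSec_oneH (x : UConf M) : SmoothSec (hadamardUnit 𝕜 E M) (oneH 𝕜 E) x := by
  rintro _ rfl hx j
  exact smoothAt_const 1 x

theorem generates_hadamardUnit : Generates (hadamardUnit 𝕜 E M) fun x => {oneH 𝕜 E x} := by
  refine fun x => eq_top_iff.2 fun t _ => Submodule.mem_span_singleton.2 ⟨ULift.down t, ?_⟩
  exact congrArg ULift.up (mul_one (ULift.down t))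

variable (𝕜 E) in
open Classical in
/-- The section of the Cauchy unit that is `1` over the empty configuration. -/
def vac (x : UConf M) : (cauchyUnit 𝕜 E M).fiber x :=
  ⟨⟨if x = ∅ then 1 else 0⟩, fun hx => congrArg ULift.up (if_neg hx)⟩

theorem vac_empty : vac 𝕜 E (∅ : UConf M) = oneC 𝕜 E M :=
  Subtype.ext (congrArg ULift.up (if_pos rfl))

theorem cauchyUnit_eq_zero {x : UConf M} (hx : x ≠ ∅) (t : (cauchyUnit 𝕜 E M).fiber x) : t = 0 :=
  Subtype.ext (t.2 hx)

/-- The chart away from the empty configuration has rank zero and hence no frame sections, so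
smoothness of maps out of the Cauchy unit is a condition at `∅` alone. -/
theorem IsFrameSec.of_cauchyUnit {s : ∀ y, (cauchyUnit 𝕜 E M).fiber y} {x : UConf M}
    (h : IsFrameSec (cauchyUnit 𝕜 E M) s x) : x = ∅ ∧ s = vac 𝕜 E := by
  obtain ⟨_, rfl | rfl, hx, i, rfl⟩ := h
  · exact ⟨hx, rfl⟩
  · exact i.elim

theorem smoothSec_vac : SmoothSec (cauchyUnit 𝕜 E M) (vac 𝕜 E) ∅ := by
  exact IsFrameSec.smoothSec ⟨_, Or.inl rfl, rfl, Unit.unit, rfl⟩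

-- The generating set is empty over `x ≠ ∅`, where the fibre is zero. In the unit axioms this leaves
-- only the summands whose unit factor sits over `∅`.
open Classical in
theorem generates_cauchyUnit :
    Generates (cauchyUnit 𝕜 E M) fun x => {t | x = ∅ ∧ t = vac 𝕜 E x} := by
  refine fun x => eq_top_iff.2 fun t _ => ?_
  by_cases hx : x = ∅
  · have : t = t.1.down • vac 𝕜 E x := by
      refine Subtype.ext (congrArg ULift.up (?_ : t.1.down = t.1.down * (if x = ∅ then 1 else 0)))
      rw [if_pos hx, mul_one]
    rw [this]
    exact Submodule.smul_mem _ _ (Submodule.subset_span ⟨hx, rfl⟩)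
  · rw [cauchyUnit_eq_zero hx t]
    exact zero_mem _

/-! ### The symmetric monoidal structure of the Hadamard tensor product -/

/-- The Hadamard tensor product of bundle maps. -/
def mapH (f : V ⟶ V') (g : W ⟶ W') : hadamard V W ⟶ hadamard V' W' :=
  homOfFrames (fun x => liftH ((mkH x).compl₁₂ (onFiber f x) (onFiber g x))) <| by
    intro x s hs
    obtain ⟨v, w, hv, hw, rfl⟩ := hs.of_hadamard
    simpa using (hv.smoothSec.map f).tmulH (hw.smoothSec.map g)

@[simp] theorem mapH_tmulH (f : V ⟶ V') (g : W ⟶ W') {x : UConf M} (v : V.fiber x)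
    (w : W.fiber x) :
    onFiber (mapH f g) x (tmulH v w) = tmulH (onFiber f x v) (onFiber g x w) :=
  liftH_tmulH _ v w

variable (V W X) in
/-- The associator of the Hadamard tensor product. -/
def assocH : hadamard (hadamard V W) X ≅ hadamard V (hadamard W X) where
  hom := homOfFrames (fun x => (TensorProduct.assoc 𝕜 _ _ _).toLinearMap) <| by
    intro x s hs
    obtain ⟨t, u, ht, hu, rfl⟩ := hs.of_hadamard
    obtain ⟨v, w, hv, hw, rfl⟩ := ht.of_hadamard
    exact hv.smoothSec.tmulH (hw.smoothSec.tmulH hu.smoothSec)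
  inv := homOfFrames (fun x => (TensorProduct.assoc 𝕜 _ _ _).symm.toLinearMap) <| by
    intro x s hs
    obtain ⟨v, t, hv, ht, rfl⟩ := hs.of_hadamard
    obtain ⟨w, u, hw, hu, rfl⟩ := ht.of_hadamard
    exact (hv.smoothSec.tmulH hw.smoothSec).tmulH hu.smoothSec
  hom_inv_id := Hom.ext (funext fun _ => LinearMap.ext (TensorProduct.assoc 𝕜 _ _ _).symm_apply_apply)
  inv_hom_id := Hom.ext (funext fun _ => LinearMap.ext (TensorProduct.assoc 𝕜 _ _ _).apply_symm_apply)

@[simp] theorem assocH_tmulH {x : UConf M} (v : V.fiber x) (w : W.fiber x) (u : X.fiber x) :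
    onFiber (assocH V W X).hom x (tmulH (tmulH v w) u) = tmulH v (tmulH w u) := rfl

variable (V W) in
/-- The braiding of the Hadamard tensor product as a bundle map. -/
def swapH : hadamard V W ⟶ hadamard W V :=
  homOfFrames (fun x => liftH (mkH x).flip) <| by
    intro x s hs
    obtain ⟨v, w, hv, hw, rfl⟩ := hs.of_hadamard
    simpa using hw.smoothSec.tmulH hv.smoothSec

@[simp] theorem swapH_tmulH {x : UConf M} (v : V.fiber x) (w : W.fiber x) :
    onFiber (swapH V W) x (tmulH v w) = tmulH w v :=
  liftH_tmulH _ v w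

variable (V W) in
theorem swapH_swapH : swapH V W ≫ swapH W V = 𝟙 _ := by
  refine ((generates_univ V).hadamard (generates_univ W)).hom_ext ?_
  rintro x _ ⟨v, -, w, -, rfl⟩
  simp

variable (V W) in
/-- The braiding of the Hadamard tensor product. -/
@[simps]
def braidingH : hadamard V W ≅ hadamard W V where
  hom := swapH V W
  inv := swapH W V
  hom_inv_id := swapH_swapH V W
  inv_hom_id := swapH_swapH W V

variable (V) in
/-- The left unitor of the Hadamard tensor product on a fibre. -/
def leftUnitorFiberH (x : UConf M) : (hadamard (hadamardUnit 𝕜 E M) V).fiber x →ₗ[𝕜] V.fiber x :=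
  liftH (LinearMap.lsmul 𝕜 (V.fiber x) ∘ₗ ULift.moduleEquiv.toLinearMap)

@[simp] theorem leftUnitorFiberH_tmulH {x : UConf M} (v : V.fiber x) :
    leftUnitorFiberH V x (tmulH (oneH 𝕜 E x) v) = v :=
  (liftH_tmulH _ (oneH 𝕜 E x) v).trans (one_smul 𝕜 v)

variable (V) in
/-- The left unitor of the Hadamard tensor product. -/
def leftUnitorH : hadamard (hadamardUnit 𝕜 E M) V ≅ V where
  hom := homOfFrames (leftUnitorFiberH V) <| by
    intro x s hs
    obtain ⟨v, w, hv, hw, rfl⟩ := hs.of_hadamard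
    obtain rfl := hv.of_hadamardUnit
    simpa using hw.smoothSec
  inv := homOfFrames (fun x => mkH x (oneH 𝕜 E x)) fun x s hs =>
    (smoothSec_oneH x).tmulH hs.smoothSec
  hom_inv_id := by
    refine (generates_hadamardUnit.hadamard (generates_univ V)).hom_ext ?_
    rintro x _ ⟨_, rfl, v, -, rfl⟩
    exact congrArg (tmulH (oneH 𝕜 E x)) (leftUnitorFiberH_tmulH v)
  inv_hom_id := (generates_univ V).hom_ext fun x v _ => leftUnitorFiberH_tmulH v

@[simp] theorem leftUnitorH_tmulH {x : UConf M} (v : V.fiber x) :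
    onFiber (leftUnitorH V).hom x (tmulH (oneH 𝕜 E x) v) = v :=
  leftUnitorFiberH_tmulH v

variable (V) in
/-- The right unitor of the Hadamard tensor product. -/
def rightUnitorH : hadamard V (hadamardUnit 𝕜 E M) ≅ V :=
  braidingH _ _ ≪≫ leftUnitorH V

@[simp] theorem rightUnitorH_tmulH {x : UConf M} (v : V.fiber x) :
    onFiber (rightUnitorH V).hom x (tmulH v (oneH 𝕜 E x)) = v := by
  simp [rightUnitorH]

variable (𝕜 E M) in
/-- The symmetric monoidal structure of the Hadamard tensor product. -/
def hadamardStructure : SymmetricMonoidalOn (VB 𝕜 E M) hadamard (hadamardUnit 𝕜 E M) where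
  map := mapH
  assoc := assocH
  leftUnitor := leftUnitorH
  rightUnitor := rightUnitorH
  braiding := braidingH
  -- Each axiom is evaluated on pure tensors, with `oneH` in the unit slots, where the formulas for
  -- the structure maps give both sides.
  map_id V W := by
    refine ((generates_univ V).hadamard (generates_univ W)).hom_ext ?_
    rintro x _ ⟨v, -, w, -, rfl⟩
    simp
  map_comp {V V' V'' W W' W''} f f' g g' := by
    refine ((generates_univ V).hadamard (generates_univ W)).hom_ext ?_
    rintro x _ ⟨v, -, w, -, rfl⟩
    simp
  assoc_naturality {V V' W W' X X'} f g h := by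
    refine (((generates_univ V).hadamard (generates_univ W)).hadamard (generates_univ X)).hom_ext ?_
    rintro x _ ⟨_, ⟨v, -, w, -, rfl⟩, u, -, rfl⟩
    simp
  leftUnitor_naturality {V V'} f := by
    refine (generates_hadamardUnit.hadamard (generates_univ V)).hom_ext ?_
    rintro x _ ⟨_, rfl, v, -, rfl⟩
    simp
  rightUnitor_naturality {V V'} f := by
    refine ((generates_univ V).hadamard generates_hadamardUnit).hom_ext ?_
    rintro x _ ⟨v, -, _, rfl, rfl⟩
    simp
  braiding_naturality {V V' W W'} f g := by
    refine ((generates_univ V).hadamard (generates_univ W)).hom_ext ?_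
    rintro x _ ⟨v, -, w, -, rfl⟩
    simp
  pentagon V W X Y := by
    refine ((((generates_univ V).hadamard (generates_univ W)).hadamard
      (generates_univ X)).hadamard (generates_univ Y)).hom_ext ?_
    rintro x _ ⟨_, ⟨_, ⟨v, -, w, -, rfl⟩, u, -, rfl⟩, t, -, rfl⟩
    simp
  triangle V W := by
    refine (((generates_univ V).hadamard generates_hadamardUnit).hadamard
      (generates_univ W)).hom_ext ?_
    rintro x _ ⟨_, ⟨v, -, _, rfl, rfl⟩, w, -, rfl⟩
    simp
  hexagon V W X := by
    refine (((generates_univ V).hadamard (generates_univ W)).hadamard (generates_univ X)).hom_ext ?_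
    rintro x _ ⟨_, ⟨v, -, w, -, rfl⟩, u, -, rfl⟩
    simp
  symmetry := swapH_swapH

/-! ### The symmetric monoidal structure of the Cauchy tensor product -/

theorem eventually_boxSec {A B : Set M} {x : UConf M} (h : Separates A B x) (v : ∀ y, V.fiber y)
    (w : ∀ y, W.fiber y) :
    ∀ᶠ y in nhds x, ∃ h : IsSplit (res A y) (res B y) y,
      boxSec A B v w y = tmulC h (v (res A y)) (w (res B y)) :=
  h.eventually.mono fun _ hy => ⟨hy.isSplit, boxSec_eq v w hy.isSplit rfl rfl⟩

/-- The Cauchy tensor product of bundle maps on a fibre. -/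
def mapFiberC (f : V ⟶ V') (g : W ⟶ W') (x : UConf M) :
    (cauchy V W).fiber x →ₗ[𝕜] (cauchy V' W').fiber x :=
  liftC fun a b h => (mkC h).compl₁₂ (onFiber f a) (onFiber g b)

theorem mapFiberC_tmulC (f : V ⟶ V') (g : W ⟶ W') {a b x : UConf M} (h : IsSplit a b x)
    (v : V.fiber a) (w : W.fiber b) :
    mapFiberC f g x (tmulC h v w) = tmulC h (onFiber f a v) (onFiber g b w) := by
  simp [mapFiberC]

/-- The Cauchy tensor product of bundle maps. -/
def mapC (f : V ⟶ V') (g : W ⟶ W') : cauchy V W ⟶ cauchy V' W' :=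
  homOfFrames (mapFiberC f g) <| by
    intro x s hs
    obtain ⟨A, B, v, w, h, hv, hw, rfl⟩ := hs.of_cauchy
    -- The image of a box section is, near `x`, the box section of the images for the same `A` and
    -- `B`; the braiding is treated in the same way with `A` and `B` exchanged.
    refine ((hv.smoothSec.map f).box h (hw.smoothSec.map g)).congr ?_
    filter_upwards [eventually_boxSec h v w] with y ⟨hy, e⟩
    rw [e, boxSec_eq _ _ hy rfl rfl, mapFiberC_tmulC]

@[simp] theorem mapC_tmulC (f : V ⟶ V') (g : W ⟶ W') {a b x : UConf M} (h : IsSplit a b x)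
    (v : V.fiber a) (w : W.fiber b) :
    onFiber (mapC f g) x (tmulC h v w) = tmulC h (onFiber f a v) (onFiber g b w) :=
  mapFiberC_tmulC f g h v w

variable (V W) in
/-- The braiding of the Cauchy tensor product on a fibre. -/
def swapFiberC (x : UConf M) : (cauchy V W).fiber x →ₗ[𝕜] (cauchy W V).fiber x :=
  liftC fun _ _ h => (mkC h.symm).flip

theorem swapFiberC_tmulC {a b x : UConf M} (h : IsSplit a b x) (v : V.fiber a)
    (w : W.fiber b) : swapFiberC V W x (tmulC h v w) = tmulC h.symm w v := by
  simp [swapFiberC]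

variable (V W) in
/-- The braiding of the Cauchy tensor product as a bundle map. -/
def swapC : cauchy V W ⟶ cauchy W V :=
  homOfFrames (swapFiberC V W) <| by
    intro x s hs
    obtain ⟨A, B, v, w, h, hv, hw, rfl⟩ := hs.of_cauchy
    refine (hw.smoothSec.box h.symm hv.smoothSec).congr ?_
    filter_upwards [eventually_boxSec h v w] with y ⟨hy, e⟩
    rw [e, boxSec_eq _ _ hy.symm rfl rfl, swapFiberC_tmulC]

@[simp] theorem swapC_tmulC {a b x : UConf M} (h : IsSplit a b x) (v : V.fiber a)
    (w : W.fiber b) : onFiber (swapC V W) x (tmulC h v w) = tmulC h.symm w v :=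
  swapFiberC_tmulC h v w

variable (V W) in
theorem swapC_swapC : swapC V W ≫ swapC W V = 𝟙 _ := by
  refine ((generates_univ V).cauchy (generates_univ W)).hom_ext ?_
  rintro x _ ⟨a, b, h, v, -, w, -, rfl⟩
  simp

variable (V W) in
/-- The braiding of the Cauchy tensor product. -/
@[simps]
def braidingC : cauchy V W ≅ cauchy W V where
  hom := swapC V W
  inv := swapC W V
  hom_inv_id := swapC_swapC V W
  inv_hom_id := swapC_swapC W V

/-- The associator of the Cauchy tensor product on a fibre. -/
def assocFiberC (x : UConf M) :
    (cauchy (cauchy V W) X).fiber x →ₗ[𝕜] (cauchy V (cauchy W X)).fiber x :=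
  liftC fun _ _ h₁ => liftC fun _ _ h₂ =>
    (LinearMap.llcomp 𝕜 _ _ _ ∘ₗ mkC (h₁.assoc_left h₂)).compl₂ (mkC (h₁.assoc_right h₂))

/-- The definition uses the complement of `a` in `x` for `b ⊔ c`. As complements are unique, the
formula holds for any splits `h₃`, `h₄`, which spares all later comparisons of fibres. -/
theorem assocFiberC_tmulC {a b c ab bc x : UConf M} (h₁ : IsSplit ab c x) (h₂ : IsSplit a b ab)
    (h₃ : IsSplit a bc x) (h₄ : IsSplit b c bc) (v : V.fiber a) (w : W.fiber b)
    (u : X.fiber c) :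
    assocFiberC x (tmulC h₁ (tmulC h₂ v w) u) = tmulC h₃ v (tmulC h₄ w u) := by
  obtain rfl := h₃.right_unique (h₁.assoc_left h₂)
  simp [assocFiberC]

variable (V W X) in
/-- The associator of the Cauchy tensor product as a bundle map. -/
def assocHomC : cauchy (cauchy V W) X ⟶ cauchy V (cauchy W X) :=
  homOfFrames assocFiberC <| by
    intro x s hs
    obtain ⟨A, B, t, u, h, ht, hu, rfl⟩ := hs.of_cauchy
    obtain ⟨A', B', v, w, h', hv, hw, rfl⟩ := ht.of_cauchy
    have e1 : ∀ y, res A' (res A y) = res (A ∩ A') y := fun y => res_res _ _ _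
    have e2 : ∀ y, res (A ∩ B') (res (A ∩ B' ∪ B) y) = res B' (res A y) := fun y => by
      rw [res_res, res_res]; congr 1; ext p; simp; tauto
    have e3 : ∀ y, res B (res (A ∩ B' ∪ B) y) = res B y := fun y => by
      rw [res_res]; congr 1; ext p; simp; tauto
    have g := h.right_of_assoc h'
    -- The reassociated section is a box section for `A ∩ A'` and `A ∩ B' ∪ B`, whose second factor
    -- is the box section for `A ∩ B'` and `B`.
    refine (SmoothSec.box (h.of_isSplit h') (e1 x ▸ hv.smoothSec)
      (SmoothSec.box (v := w) (w := u) g ?_ ?_)).congr ?_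
    · rw [e2]; exact hw.smoothSec
    · rw [e3]; exact hu.smoothSec
    filter_upwards [h.eventually, (h.of_isSplit h').eventually] with y hy hy'
    have k := h.left_of_assoc h' hy'
    have k3 := hy'.isSplit
    have k4 := (hy.right_of_assoc k).isSplit
    rw [boxSec_eq _ _ hy.isSplit rfl rfl, boxSec_eq _ _ k.isSplit rfl rfl]
    rw [← e1] at k3
    rw [e2, e3] at k4
    rw [assocFiberC_tmulC hy.isSplit k.isSplit k3 k4, boxSec_eq _ _ k3 (e1 y).symm rfl,
      boxSec_eq _ _ k4 (e2 y) (e3 y)]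

theorem assocHomC_tmulC {a b c ab bc x : UConf M} (h₁ : IsSplit ab c x) (h₂ : IsSplit a b ab)
    (h₃ : IsSplit a bc x) (h₄ : IsSplit b c bc) (v : V.fiber a) (w : W.fiber b)
    (u : X.fiber c) :
    onFiber (assocHomC V W X) x (tmulC h₁ (tmulC h₂ v w) u) = tmulC h₃ v (tmulC h₄ w u) :=
  assocFiberC_tmulC h₁ h₂ h₃ h₄ v w u

variable (V W X) in
/-- The inverse of the associator of the Cauchy tensor product. -/
def assocInvC : cauchy V (cauchy W X) ⟶ cauchy (cauchy V W) X :=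
  -- The associator for the reversed order of factors, conjugated by flips: `v(wu) ↦ (wu)v ↦ (uw)v ↦
  -- u(wv) ↦ (wv)u ↦ (vw)u`. Its smoothness is then inherited.
  swapC _ _ ≫ mapC (swapC W X) (𝟙 V) ≫ assocHomC X W V ≫ swapC _ _ ≫ mapC (swapC W V) (𝟙 X)

theorem assocInvC_tmulC {a b c ab bc x : UConf M} (h₁ : IsSplit ab c x) (h₂ : IsSplit a b ab)
    (h₃ : IsSplit a bc x) (h₄ : IsSplit b c bc) (v : V.fiber a) (w : W.fiber b)
    (u : X.fiber c) :
    onFiber (assocInvC V W X) x (tmulC h₃ v (tmulC h₄ w u)) = tmulC h₁ (tmulC h₂ v w) u := by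
  simp [assocInvC, assocHomC_tmulC h₃.symm h₄.symm h₁.symm h₂.symm]

variable (V W X) in
/-- The associator of the Cauchy tensor product. -/
@[simps]
def assocC : cauchy (cauchy V W) X ≅ cauchy V (cauchy W X) where
  hom := assocHomC V W X
  inv := assocInvC V W X
  hom_inv_id := by
    refine (((generates_univ V).cauchy (generates_univ W)).cauchy (generates_univ X)).hom_ext ?_
    rintro x _ ⟨d, c, h₁, _, ⟨a, b, h₂, v, -, w, -, rfl⟩, u, -, rfl⟩
    rw [comp_app, assocHomC_tmulC h₁ h₂ (h₁.assoc_left h₂) (h₁.assoc_right h₂), assocInvC_tmulC h₁ h₂,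
      id_app]
  inv_hom_id := by
    refine ((generates_univ V).cauchy ((generates_univ W).cauchy (generates_univ X))).hom_ext ?_
    rintro x _ ⟨a, d, h₁, v, -, _, ⟨b, c, h₂, w, -, u, -, rfl⟩, rfl⟩
    have h₃ := (h₁.symm.assoc_left h₂.symm).symm
    have h₄ := (h₁.symm.assoc_right h₂.symm).symm
    rw [comp_app, assocInvC_tmulC h₃ h₄, assocHomC_tmulC h₃ h₄ h₁ h₂, id_app]

/-- The identification of the fibres over equal configurations. -/
def castFiber {a b : UConf M} (h : a = b) : V.fiber a →ₗ[𝕜] V.fiber b :=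
  h ▸ LinearMap.id

@[simp] theorem castFiber_rfl {a : UConf M} (v : V.fiber a) : castFiber rfl v = v := rfl

variable (𝕜 E) in
/-- The inclusion of the fibres of the Cauchy unit into the scalars. -/
def vacScalar (x : UConf M) : (cauchyUnit 𝕜 E M).fiber x →ₗ[𝕜] 𝕜 :=
  ULift.moduleEquiv.toLinearMap ∘ₗ (vacuumFiber 𝕜 x).subtype

open Classical in
@[simp] theorem vacScalar_vac_empty : vacScalar 𝕜 E ∅ (vac 𝕜 E (∅ : UConf M)) = 1 :=
  show (if (∅ : UConf M) = ∅ then (1 : 𝕜) else 0) = 1 from if_pos rfl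

variable (V) in
open Classical in
/-- The left unitor of the Cauchy tensor product on a fibre. -/
def leftUnitorFiberC (x : UConf M) : (cauchy (cauchyUnit 𝕜 E M) V).fiber x →ₗ[𝕜] V.fiber x :=
  -- If `a = ∅` then `b` equals `x` only propositionally, hence the cast; for the other splits the
  -- unit factor vanishes, so zero loses nothing.
  liftC fun a b h => if ha : a = ∅ then
      (LinearMap.lsmul 𝕜 (V.fiber x) ∘ₗ vacScalar 𝕜 E a).compl₂
        (castFiber ((ha ▸ h : IsSplit ∅ b x).eq_of_left))
    else 0

theorem leftUnitorFiberC_tmulC {x : UConf M} (h : IsSplit ∅ x x) (v : V.fiber x) :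
    leftUnitorFiberC V x (tmulC h (vac 𝕜 E ∅) v) = v := by
  simp [leftUnitorFiberC]

variable (V) in
/-- The left unitor of the Cauchy tensor product. -/
def leftUnitorC : cauchy (cauchyUnit 𝕜 E M) V ≅ V where
  hom := homOfFrames (leftUnitorFiberC V) <| by
    intro x s hs
    obtain ⟨A, B, t, v, h, ht, hv, rfl⟩ := hs.of_cauchy
    obtain ⟨hA, rfl⟩ := ht.of_cauchyUnit
    -- Since the unit has frame sections only at `∅`, the set `A` contains no point of `x`, so `x`
    -- lies in `B`. This is an open condition, under which the split is the trivial one.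
    have hB : ∀ y, (∀ p ∈ y, p ∈ B) → res B y = y := fun y hy => by
      ext p; simpa using hy p
    have hx : ∀ p ∈ x, p ∈ B := fun p hp => by
      refine (h.subset p hp).resolve_left fun hpA => ?_
      have : p ∈ res A x := mem_res.2 ⟨hp, hpA⟩
      simp [hA] at this
    rw [hB x hx] at hv
    refine hv.smoothSec.congr ?_
    filter_upwards [(UConf.isOpen_forall_mem h.2).mem_nhds hx] with y hy
    have hy' : res A y = ∅ := by
      ext p
      simpa using fun hp hpA => h.not_mem hpA (hy p hp)
    rw [boxSec_eq _ _ (IsSplit.empty_left y) hy' (hB y hy), leftUnitorFiberC_tmulC]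
  inv := homOfFrames (fun x => mkC (IsSplit.empty_left x) (vac 𝕜 E ∅)) <| by
    intro x s hs
    -- The separation into `∅` and `M` is valid at every configuration and cuts out exactly the
    -- trivial split.
    have h : ∀ y, Separates (∅ : Set M) Set.univ y := fun y =>
      ⟨isOpen_empty, isOpen_univ, by simp, by simp⟩
    have e1 : ∀ y : UConf M, res ∅ y = ∅ := fun y => by ext; simp
    have e2 : ∀ y : UConf M, res Set.univ y = y := fun y => by ext; simp
    refine (SmoothSec.box (v := vac 𝕜 E) (h x) (e1 x ▸ smoothSec_vac)
      ((e2 x).symm ▸ hs.smoothSec)).congr (.of_forall fun y => ?_)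
    rw [boxSec_eq _ _ (IsSplit.empty_left y) (e1 y) (e2 y), mkC_apply]
  hom_inv_id := by
    refine (generates_cauchyUnit.cauchy (generates_univ V)).hom_ext ?_
    rintro x _ ⟨_, b, h, _, ⟨rfl, rfl⟩, v, -, rfl⟩
    obtain rfl := h.eq_of_left
    simp [leftUnitorFiberC_tmulC]
  inv_hom_id := by
    refine (generates_univ V).hom_ext fun x v _ => ?_
    simp [leftUnitorFiberC_tmulC]

@[simp] theorem leftUnitorC_tmulC {x : UConf M} (h : IsSplit ∅ x x) (v : V.fiber x) :
    onFiber (leftUnitorC V).hom x (tmulC h (vac 𝕜 E ∅) v) = v :=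
  leftUnitorFiberC_tmulC h v

variable (V) in
/-- The right unitor of the Cauchy tensor product. -/
def rightUnitorC : cauchy V (cauchyUnit 𝕜 E M) ≅ V :=
  braidingC _ _ ≪≫ leftUnitorC V

@[simp] theorem rightUnitorC_tmulC {x : UConf M} (h : IsSplit x ∅ x) (v : V.fiber x) :
    onFiber (rightUnitorC V).hom x (tmulC h v (vac 𝕜 E ∅)) = v := by
  simp [rightUnitorC]

variable (𝕜 E M) in
/-- The symmetric monoidal structure of the Cauchy tensor product. -/
def cauchyStructure : SymmetricMonoidalOn (VB 𝕜 E M) cauchy (cauchyUnit 𝕜 E M) where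
  map := mapC
  assoc := assocC
  leftUnitor := leftUnitorC
  rightUnitor := rightUnitorC
  braiding := braidingC
  map_id V W := by
    refine ((generates_univ V).cauchy (generates_univ W)).hom_ext ?_
    rintro x _ ⟨a, b, h, v, -, w, -, rfl⟩
    simp
  map_comp {V V' V'' W W' W''} f f' g g' := by
    refine ((generates_univ V).cauchy (generates_univ W)).hom_ext ?_
    rintro x _ ⟨a, b, h, v, -, w, -, rfl⟩
    simp
  assoc_naturality {V V' W W' X X'} f g h := by
    refine (((generates_univ V).cauchy (generates_univ W)).cauchy (generates_univ X)).hom_ext ?_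
    rintro x _ ⟨d, c, h₁, _, ⟨a, b, h₂, v, -, w, -, rfl⟩, u, -, rfl⟩
    simp [assocHomC_tmulC h₁ h₂ (h₁.assoc_left h₂) (h₁.assoc_right h₂)]
  leftUnitor_naturality {V V'} f := by
    refine (generates_cauchyUnit.cauchy (generates_univ V)).hom_ext ?_
    rintro x _ ⟨_, b, h, _, ⟨rfl, rfl⟩, v, -, rfl⟩
    obtain rfl := h.eq_of_left
    simp
  rightUnitor_naturality {V V'} f := by
    refine ((generates_univ V).cauchy generates_cauchyUnit).hom_ext ?_
    rintro x _ ⟨a, _, h, v, -, _, ⟨rfl, rfl⟩, rfl⟩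
    obtain rfl := h.symm.eq_of_left
    simp
  braiding_naturality {V V' W W'} f g := by
    refine ((generates_univ V).cauchy (generates_univ W)).hom_ext ?_
    rintro x _ ⟨a, b, h, v, -, w, -, rfl⟩
    simp
  pentagon V W X Y := by
    refine ((((generates_univ V).cauchy (generates_univ W)).cauchy
      (generates_univ X)).cauchy (generates_univ Y)).hom_ext ?_
    rintro x _ ⟨abc, d, h₁, _, ⟨ab, c, h₂, _, ⟨a, b, h₃, v, -, w, -, rfl⟩, u, -, rfl⟩, t, -, rfl⟩
    -- the splits of `a ⊔ ((b ⊔ c) ⊔ d)`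
    have k₁ := h₂.assoc_left h₃
    have k₂ := h₂.assoc_right h₃
    have k₃ := h₁.assoc_left k₁
    have k₄ := h₁.assoc_right k₁
    have k₅ := k₄.assoc_left k₂
    have k₆ := k₄.assoc_right k₂
    -- the splits of `(a ⊔ b) ⊔ (c ⊔ d)`
    have l₁ := h₁.assoc_left h₂
    have l₂ := h₁.assoc_right h₂
    -- The two paths write `c ⊔ d` differently: as the complement of `b` in the complement of `a`,
    -- and as the complement of `a ⊔ b` in `x`. Uniqueness of complements identifies them.
    have e₁ := k₃.right_unique (l₁.assoc_left h₃)
    have e₂ := k₅.right_unique (e₁ ▸ l₁.assoc_right h₃)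
    rw [← e₂] at l₁ l₂
    simp only [comp_app, assocC_hom, mapC_tmulC, id_app, assocHomC_tmulC h₂ h₃ k₁ k₂,
      assocHomC_tmulC h₁ k₁ k₃ k₄, assocHomC_tmulC k₄ k₂ k₅ k₆, assocHomC_tmulC h₁ h₂ l₁ l₂]
    rw [assocHomC_tmulC l₁ h₃ k₃ k₅]
  triangle V W := by
    refine (((generates_univ V).cauchy generates_cauchyUnit).cauchy
      (generates_univ W)).hom_ext ?_
    rintro x _ ⟨d, c, h₁, _, ⟨a, _, h₂, v, -, _, ⟨rfl, rfl⟩, rfl⟩, w, -, rfl⟩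
    obtain rfl := h₂.symm.eq_of_left
    simp [assocHomC_tmulC h₁ h₂ h₁ (IsSplit.empty_left c)]
  hexagon V W X := by
    refine (((generates_univ V).cauchy (generates_univ W)).cauchy (generates_univ X)).hom_ext ?_
    rintro x _ ⟨d, c, h₁, _, ⟨a, b, h₂, v, -, w, -, rfl⟩, u, -, rfl⟩
    have k₁ := h₁.assoc_left h₂
    have k₂ := h₁.assoc_right h₂
    have l₁ := h₁.assoc_left h₂.symm
    have l₂ := h₁.assoc_right h₂.symm
    simp [assocHomC_tmulC h₁ h₂ k₁ k₂, assocHomC_tmulC k₁.symm k₂ l₁ l₂.symm,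
      assocHomC_tmulC h₁ h₂.symm l₁ l₂]
  symmetry := swapC_swapC

/-! ### The structure maps between the units -/

variable (𝕜 E) in
/-- The multiplication of the Hadamard unit on a fibre. -/
def mulFiber (x : UConf M) :
    (cauchy (hadamardUnit 𝕜 E M) (hadamardUnit 𝕜 E M)).fiber x →ₗ[𝕜]
      (hadamardUnit 𝕜 E M).fiber x :=
  liftC fun _ _ _ => ((LinearMap.mul 𝕜 𝕜).compl₁₂ (ULift.moduleEquiv (R := 𝕜)).toLinearMap
    (ULift.moduleEquiv (R := 𝕜)).toLinearMap).compr₂ (ULift.moduleEquiv (R := 𝕜)).symm.toLinearMap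

theorem mulFiber_tmulC {a b x : UConf M} (h : IsSplit a b x) :
    mulFiber 𝕜 E x (tmulC h (oneH 𝕜 E a) (oneH 𝕜 E b)) = oneH 𝕜 E x :=
  (liftC_tmulC _ h _ _).trans (congrArg ULift.up (mul_one (1 : 𝕜)))

variable (𝕜 E M) in
/-- The multiplication of the Hadamard unit with respect to the Cauchy tensor product. -/
def mul : cauchy (hadamardUnit 𝕜 E M) (hadamardUnit 𝕜 E M) ⟶ hadamardUnit 𝕜 E M :=
  homOfFrames (mulFiber 𝕜 E) <| by
    intro x s hs
    obtain ⟨A, B, v, w, h, hv, hw, rfl⟩ := hs.of_cauchy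
    obtain rfl := hv.of_hadamardUnit
    obtain rfl := hw.of_hadamardUnit
    refine (smoothSec_oneH x).congr ?_
    filter_upwards [eventually_boxSec h (oneH 𝕜 E) (oneH 𝕜 E)] with y ⟨hy, e⟩
    rw [e, mulFiber_tmulC]

@[simp] theorem mul_tmulC {a b x : UConf M} (h : IsSplit a b x) :
    onFiber (mul 𝕜 E M) x (tmulC h (oneH 𝕜 E a) (oneH 𝕜 E b)) = oneH 𝕜 E x :=
  mulFiber_tmulC h

/-- The empty configuration is an isolated point, so smoothness of `comul` and `incl` comes down to
their values there. -/
theorem eventually_eq_empty : ∀ᶠ y in nhds (∅ : UConf M), y = ∅ :=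
  (isOpen_vacuum M).mem_nhds rfl

variable (𝕜 E M) in
/-- The comultiplication of the Cauchy unit with respect to the Hadamard tensor product. -/
def comul : cauchyUnit 𝕜 E M ⟶ hadamard (cauchyUnit 𝕜 E M) (cauchyUnit 𝕜 E M) :=
  homOfFrames (fun x => (vacScalar 𝕜 E x).smulRight (tmulH (vac 𝕜 E x) (vac 𝕜 E x))) <| by
    intro x s hs
    obtain ⟨rfl, rfl⟩ := hs.of_cauchyUnit
    refine (smoothSec_vac.tmulH smoothSec_vac).congr ?_
    filter_upwards [eventually_eq_empty] with y hy
    subst hy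
    rw [LinearMap.smulRight_apply, vacScalar_vac_empty, one_smul]

@[simp] theorem comul_vac :
    onFiber (comul 𝕜 E M) ∅ (vac 𝕜 E ∅) = tmulH (vac 𝕜 E ∅) (vac 𝕜 E ∅) := by
  refine (LinearMap.smulRight_apply _ _ _).trans ?_
  rw [vacScalar_vac_empty, one_smul]

variable (𝕜 E M) in
/-- The inclusion of the Cauchy unit into the Hadamard unit. -/
def incl : cauchyUnit 𝕜 E M ⟶ hadamardUnit 𝕜 E M :=
  homOfFrames (fun x => (vacuumFiber 𝕜 x).subtype) <| by
    intro x s hs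
    obtain ⟨rfl, rfl⟩ := hs.of_cauchyUnit
    refine (smoothSec_oneH ∅).congr ?_
    filter_upwards [eventually_eq_empty] with y hy
    subst hy
    exact congrArg ULift.up (if_pos rfl).symm

@[simp] theorem incl_vac : onFiber (incl 𝕜 E M) ∅ (vac 𝕜 E ∅) = oneH 𝕜 E ∅ :=
  congrArg ULift.up (if_pos rfl)

theorem onFiber_cauchyUnit_eq_zero (f : cauchyUnit 𝕜 E M ⟶ V) {x : UConf M} (hx : x ≠ ∅) :
    onFiber f x = 0 :=
  LinearMap.ext fun t => by rw [cauchyUnit_eq_zero hx t, map_zero, map_zero]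

/-! ### The shuffle map -/

variable (V W V' W') in
/-- The shuffle map on a fibre. -/
def shuffleFiber (x : UConf M) :
    (cauchy (hadamard V W) (hadamard V' W')).fiber x →ₗ[𝕜]
      (hadamard (cauchy V V') (cauchy W W')).fiber x :=
  liftC fun _ _ h => TensorProduct.curry <|
    TensorProduct.map (TensorProduct.lift (mkC h)) (TensorProduct.lift (mkC h)) ∘ₗ
      (TensorProduct.tensorTensorTensorComm 𝕜 _ _ _ _).toLinearMap

theorem shuffleFiber_tmulC {a b x : UConf M} (h : IsSplit a b x) (v : V.fiber a) (w : W.fiber a)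
    (v' : V'.fiber b) (w' : W'.fiber b) :
    shuffleFiber V W V' W' x (tmulC h (tmulH v w) (tmulH v' w')) =
      tmulH (tmulC h v v') (tmulC h w w') :=
  (liftC_tmulC _ h _ _).trans rfl

variable (V W V' W') in
/-- The shuffle map. -/
def shuffle : cauchy (hadamard V W) (hadamard V' W') ⟶ hadamard (cauchy V V') (cauchy W W') :=
  homOfFrames (shuffleFiber V W V' W') <| by
    intro x s hs
    obtain ⟨A, B, t, t', h, ht, ht', rfl⟩ := hs.of_cauchy
    obtain ⟨v, w, hv, hw, rfl⟩ := ht.of_hadamard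
    obtain ⟨v', w', hv', hw', rfl⟩ := ht'.of_hadamard
    -- The same pair `A`, `B` cuts both box sections, which is why their tensor lies in the summand
    -- where the two splits agree.
    refine ((hv.smoothSec.box h hv'.smoothSec).tmulH (hw.smoothSec.box h hw'.smoothSec)).congr ?_
    filter_upwards [h.eventually] with y hy
    rw [boxSec_eq _ _ hy.isSplit rfl rfl, boxSec_eq _ _ hy.isSplit rfl rfl,
      boxSec_eq _ _ hy.isSplit rfl rfl, shuffleFiber_tmulC]

@[simp] theorem shuffle_tmulC {a b x : UConf M} (h : IsSplit a b x) (v : V.fiber a)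
    (w : W.fiber a) (v' : V'.fiber b) (w' : W'.fiber b) :
    onFiber (shuffle V W V' W') x (tmulC h (tmulH v w) (tmulH v' w')) =
      tmulH (tmulC h v v') (tmulC h w w') :=
  shuffleFiber_tmulC h v w v' w'

/-! ### Injectivity of the shuffle map -/

/-- The projection of a fibre of the Cauchy tensor product to the summand of a split. -/
def projC {x : UConf M} (s : Split x) :
    (cauchy V W).fiber x →ₗ[𝕜] V.fiber s.left ⊗[𝕜] W.fiber s.right :=
  DirectSum.component 𝕜 (Split x) (fun s => V.fiber s.left ⊗[𝕜] W.fiber s.right) s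

theorem projC_tmulC {x : UConf M} (s : Split x) (v : V.fiber s.left) (w : W.fiber s.right) :
    projC s (tmulC s.isSplit v w) = v ⊗ₜ w :=
  DFinsupp.single_eq_same

theorem projC_tmulC_of_ne {x : UConf M} (s : Split x) {a b : UConf M} (h : IsSplit a b x)
    (hs : (⟨a, b, h⟩ : Split x) ≠ s) (v : V.fiber a) (w : W.fiber b) :
    projC s (tmulC h v w) = 0 :=
  DFinsupp.single_eq_of_ne (Ne.symm hs)

/-- The projection of a fibre of a Hadamard product of Cauchy products to the tensor product of the
summands of the same split. -/
def projHC {x : UConf M} (s : Split x) :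
    (hadamard (cauchy V V') (cauchy W W')).fiber x →ₗ[𝕜]
      (V.fiber s.left ⊗[𝕜] V'.fiber s.right) ⊗[𝕜] (W.fiber s.left ⊗[𝕜] W'.fiber s.right) :=
  liftH ((TensorProduct.mk 𝕜 _ _).compl₁₂ (projC s) (projC s))

theorem projHC_tmulH {x : UConf M} (s : Split x) (t : (cauchy V V').fiber x)
    (t' : (cauchy W W').fiber x) : projHC s (tmulH t t') = projC s t ⊗ₜ projC s t' := by
  simp [projHC]

/-- The projection of a fibre of a Cauchy product of Hadamard products to the summand of a split,
with the middle factors interchanged. -/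
def projCH {x : UConf M} (s : Split x) :
    (cauchy (hadamard V W) (hadamard V' W')).fiber x →ₗ[𝕜]
      (V.fiber s.left ⊗[𝕜] V'.fiber s.right) ⊗[𝕜] (W.fiber s.left ⊗[𝕜] W'.fiber s.right) :=
  (TensorProduct.tensorTensorTensorComm 𝕜 _ _ _ _).toLinearMap ∘ₗ projC s

/-- Seen in the summand where both splits are `s`, the shuffle map is the interchange isomorphism on
the component at `s`; pure tensors from any other split contribute zero on both sides. -/
theorem projHC_comp_shuffle {x : UConf M} (s : Split x) :
    projHC s ∘ₗ onFiber (shuffle V W V' W') x = projCH s := by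
  refine LinearMap.ext_on ((((generates_univ V).hadamard (generates_univ W)).cauchy
    ((generates_univ V').hadamard (generates_univ W'))) x) ?_
  rintro _ ⟨a, b, h, _, ⟨v, -, w, -, rfl⟩, _, ⟨v', -, w', -, rfl⟩, rfl⟩
  rw [LinearMap.comp_apply, shuffle_tmulC, projHC_tmulH]
  by_cases hs : (⟨a, b, h⟩ : Split x) = s
  · subst hs
    rw [projC_tmulC ⟨a, b, h⟩, projC_tmulC ⟨a, b, h⟩]
    exact (congrArg (TensorProduct.tensorTensorTensorComm 𝕜 _ _ _ _)
      (projC_tmulC (V := hadamard V W) (W := hadamard V' W') ⟨a, b, h⟩ (tmulH v w)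
        (tmulH v' w'))).symm
  · rw [projC_tmulC_of_ne s h hs, TensorProduct.zero_tmul]
    exact ((congrArg (TensorProduct.tensorTensorTensorComm 𝕜 _ _ _ _)
      (projC_tmulC_of_ne (V := hadamard V W) (W := hadamard V' W') s h hs (tmulH v w)
        (tmulH v' w'))).trans (map_zero _)).symm

/-- An element of the direct sum is determined by its components, and each component is recovered
from its image because the interchange is bijective. -/
theorem shuffle_injective (x : UConf M) :
    Function.Injective (onFiber (shuffle V W V' W') x) := by
  intro t t' h
  refine DFinsupp.ext fun s => ?_
  refine (TensorProduct.tensorTensorTensorComm 𝕜 (V.fiber s.left) (W.fiber s.left)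
    (V'.fiber s.right) (W'.fiber s.right)).injective ?_
  have h1 := LinearMap.congr_fun (projHC_comp_shuffle (V := V) (W := W) (V' := V') (W' := W') s)
  exact (h1 t).symm.trans ((congrArg (projHC s) h).trans (h1 t'))

/-! ### Verification of the 2-monoidal axioms -/

variable (𝕜 E M) in
/-- The symmetric 2-monoidal structure given by the Cauchy and the Hadamard tensor products. -/
def twoMonoidalStructure : SymmetricTwoMonoidalOn (VB 𝕜 E M) cauchy (cauchyUnit 𝕜 E M)
    hadamard (hadamardUnit 𝕜 E M) where
  fst := cauchyStructure 𝕜 E M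
  snd := hadamardStructure 𝕜 E M
  sh := shuffle
  μ := mul 𝕜 E M
  Δ := comul 𝕜 E M
  ν := incl 𝕜 E M
  sh_naturality {A₁ A₂ B₁ B₂ A₁' A₂' B₁' B₂'} a b a' b' := by
    refine (((generates_univ A₁).hadamard (generates_univ B₁)).cauchy
      ((generates_univ A₁').hadamard (generates_univ B₁'))).hom_ext ?_
    rintro x _ ⟨p, q, h, _, ⟨v, -, w, -, rfl⟩, _, ⟨v', -, w', -, rfl⟩, rfl⟩
    simp [cauchyStructure, hadamardStructure]
  sh_assoc_fst A B A' B' A'' B'' := by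
    refine ((((generates_univ A).hadamard (generates_univ B)).cauchy
      ((generates_univ A').hadamard (generates_univ B'))).cauchy
      ((generates_univ A'').hadamard (generates_univ B''))).hom_ext ?_
    rintro x _ ⟨d, r, h₁, _, ⟨p, q, h₂, _, ⟨v, -, w, -, rfl⟩, _, ⟨v', -, w', -, rfl⟩, rfl⟩,
      _, ⟨v'', -, w'', -, rfl⟩, rfl⟩
    -- Both tensor factors of the target are reassociated over the same splits, so one pair `k₁`,
    -- `k₂` serves the associators of the `A`'s and of the `B`'s.
    have k₁ := h₁.assoc_left h₂
    have k₂ := h₁.assoc_right h₂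
    simp [cauchyStructure, hadamardStructure, assocHomC_tmulC h₁ h₂ k₁ k₂]
  sh_assoc_snd A B D A' B' D' := by
    refine ((((generates_univ A).hadamard (generates_univ B)).hadamard (generates_univ D)).cauchy
      (((generates_univ A').hadamard (generates_univ B')).hadamard (generates_univ D'))).hom_ext ?_
    rintro x _ ⟨p, q, h, _, ⟨_, ⟨v, -, w, -, rfl⟩, u, -, rfl⟩,
      _, ⟨_, ⟨v', -, w', -, rfl⟩, u', -, rfl⟩, rfl⟩
    simp [cauchyStructure, hadamardStructure]
  sh_leftUnitor_fst A B := by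
    refine (generates_cauchyUnit.cauchy
      ((generates_univ A).hadamard (generates_univ B))).hom_ext ?_
    rintro x _ ⟨_, q, h, _, ⟨rfl, rfl⟩, _, ⟨v, -, w, -, rfl⟩, rfl⟩
    obtain rfl := h.eq_of_left
    simp [cauchyStructure, hadamardStructure]
  sh_rightUnitor_fst A B := by
    refine (((generates_univ A).hadamard (generates_univ B)).cauchy
      generates_cauchyUnit).hom_ext ?_
    rintro x _ ⟨p, _, h, _, ⟨v, -, w, -, rfl⟩, _, ⟨rfl, rfl⟩, rfl⟩
    obtain rfl := h.symm.eq_of_left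
    simp [cauchyStructure, hadamardStructure]
  sh_leftUnitor_snd A A' := by
    refine ((generates_hadamardUnit.hadamard (generates_univ A)).cauchy
      (generates_hadamardUnit.hadamard (generates_univ A'))).hom_ext ?_
    rintro x _ ⟨p, q, h, _, ⟨_, rfl, v, -, rfl⟩, _, ⟨_, rfl, v', -, rfl⟩, rfl⟩
    simp [cauchyStructure, hadamardStructure]
  sh_rightUnitor_snd A A' := by
    refine (((generates_univ A).hadamard generates_hadamardUnit).cauchy
      ((generates_univ A').hadamard generates_hadamardUnit)).hom_ext ?_
    rintro x _ ⟨p, q, h, _, ⟨v, -, _, rfl, rfl⟩, _, ⟨v', -, _, rfl, rfl⟩, rfl⟩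
    simp [cauchyStructure, hadamardStructure]
  μ_assoc := by
    refine ((generates_hadamardUnit.cauchy generates_hadamardUnit).cauchy
      generates_hadamardUnit).hom_ext ?_
    rintro x _ ⟨d, r, h₁, _, ⟨p, q, h₂, _, rfl, _, rfl, rfl⟩, _, rfl, rfl⟩
    simp [cauchyStructure, assocHomC_tmulC h₁ h₂ (h₁.assoc_left h₂) (h₁.assoc_right h₂)]
  ν_μ := by
    refine (generates_cauchyUnit.cauchy generates_hadamardUnit).hom_ext ?_
    rintro x _ ⟨_, q, h, _, ⟨rfl, rfl⟩, _, rfl, rfl⟩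
    obtain rfl := h.eq_of_left
    simp [cauchyStructure]
  μ_ν := by
    refine (generates_hadamardUnit.cauchy generates_cauchyUnit).hom_ext ?_
    rintro x _ ⟨p, _, h, _, rfl, _, ⟨rfl, rfl⟩, rfl⟩
    obtain rfl := h.symm.eq_of_left
    simp [cauchyStructure]
  μ_comm := by
    refine (generates_hadamardUnit.cauchy generates_hadamardUnit).hom_ext ?_
    rintro x _ ⟨p, q, h, _, rfl, _, rfl, rfl⟩
    simp [cauchyStructure]
  Δ_assoc := by
    refine generates_cauchyUnit.hom_ext ?_
    rintro x _ ⟨rfl, rfl⟩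
    simp [hadamardStructure]
  Δ_ν_left := by
    refine generates_cauchyUnit.hom_ext ?_
    rintro x _ ⟨rfl, rfl⟩
    simp [hadamardStructure]
  Δ_ν_right := by
    refine generates_cauchyUnit.hom_ext ?_
    rintro x _ ⟨rfl, rfl⟩
    simp [hadamardStructure]
  Δ_comm := by
    refine generates_cauchyUnit.hom_ext ?_
    rintro x _ ⟨rfl, rfl⟩
    simp [hadamardStructure]
  sh_braiding_fst A B A' B' := by
    refine (((generates_univ A).hadamard (generates_univ B)).cauchy
      ((generates_univ A').hadamard (generates_univ B'))).hom_ext ?_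
    rintro x _ ⟨p, q, h, _, ⟨v, -, w, -, rfl⟩, _, ⟨v', -, w', -, rfl⟩, rfl⟩
    simp [cauchyStructure, hadamardStructure]
  sh_braiding_snd A B A' B' := by
    refine (((generates_univ A).hadamard (generates_univ B)).cauchy
      ((generates_univ A').hadamard (generates_univ B'))).hom_ext ?_
    rintro x _ ⟨p, q, h, _, ⟨v, -, w, -, rfl⟩, _, ⟨v', -, w', -, rfl⟩, rfl⟩
    simp [cauchyStructure, hadamardStructure]

end VB

end bundleMaps

/-- The category of smooth `𝕜`-vector bundles over the unordered configuration space of a smooth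
manifold `M`, with the Cauchy and the Hadamard tensor products, is a symmetric 2-monoidal category,
whose structure maps are the ones described on generators of the fibres. -/
theorem mainTheorem3 (𝕜 : Type) [RCLike 𝕜] (E : Type v) [NormedAddCommGroup E] [NormedSpace ℝ E]
    [FiniteDimensional ℝ E] (M : Type u) [TopologicalSpace M] [T2Space M] [ChartedSpace E M]
    [IsManifold 𝓘(ℝ, E) ∞ M] :
    ∃ S : SymmetricTwoMonoidalOn (VB 𝕜 E M) VB.cauchy (VB.cauchyUnit 𝕜 E M)
        VB.hadamard (VB.hadamardUnit 𝕜 E M),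
      -- the symmetric monoidal structure of the Hadamard tensor product
      (∀ (V V' W W' : VB 𝕜 E M) (f : V ⟶ V') (g : W ⟶ W') (x : UConf M) (v : V.fiber x)
        (w : W.fiber x), VB.onFiber (S.snd.map f g) x (VB.tmulH v w) =
          VB.tmulH (VB.onFiber f x v) (VB.onFiber g x w)) ∧
      (∀ (V W X : VB 𝕜 E M) (x : UConf M) (v : V.fiber x) (w : W.fiber x) (u : X.fiber x),
        VB.onFiber (S.snd.assoc V W X).hom x (VB.tmulH (VB.tmulH v w) u) =
          VB.tmulH v (VB.tmulH w u)) ∧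
      (∀ (V : VB 𝕜 E M) (x : UConf M) (v : V.fiber x),
        VB.onFiber (S.snd.leftUnitor V).hom x (VB.tmulH (VB.oneH 𝕜 E x) v) = v ∧
        VB.onFiber (S.snd.rightUnitor V).hom x (VB.tmulH v (VB.oneH 𝕜 E x)) = v) ∧
      (∀ (V W : VB 𝕜 E M) (x : UConf M) (v : V.fiber x) (w : W.fiber x),
        VB.onFiber (S.snd.braiding V W).hom x (VB.tmulH v w) = VB.tmulH w v) ∧
      -- the symmetric monoidal structure of the Cauchy tensor product
      (∀ (V V' W W' : VB 𝕜 E M) (f : V ⟶ V') (g : W ⟶ W') (a b x : UConf M) (h : IsSplit a b x)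
        (v : V.fiber a) (w : W.fiber b), VB.onFiber (S.fst.map f g) x (VB.tmulC h v w) =
          VB.tmulC h (VB.onFiber f a v) (VB.onFiber g b w)) ∧
      (∀ (V W X : VB 𝕜 E M) (a b c ab bc x : UConf M) (h₁ : IsSplit ab c x) (h₂ : IsSplit a b ab)
        (h₃ : IsSplit a bc x) (h₄ : IsSplit b c bc) (v : V.fiber a) (w : W.fiber b)
        (u : X.fiber c),
        VB.onFiber (S.fst.assoc V W X).hom x (VB.tmulC h₁ (VB.tmulC h₂ v w) u) =
          VB.tmulC h₃ v (VB.tmulC h₄ w u)) ∧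
      (∀ (V : VB 𝕜 E M) (x : UConf M) (h : IsSplit ∅ x x) (h' : IsSplit x ∅ x) (v : V.fiber x),
        VB.onFiber (S.fst.leftUnitor V).hom x (VB.tmulC h (VB.oneC 𝕜 E M) v) = v ∧
        VB.onFiber (S.fst.rightUnitor V).hom x (VB.tmulC h' v (VB.oneC 𝕜 E M)) = v) ∧
      (∀ (V W : VB 𝕜 E M) (a b x : UConf M) (h : IsSplit a b x) (h' : IsSplit b a x)
        (v : V.fiber a) (w : W.fiber b),
        VB.onFiber (S.fst.braiding V W).hom x (VB.tmulC h v w) = VB.tmulC h' w v) ∧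
      -- the maps `μ`, `Δ` and `ν`
      (∀ (a b x : UConf M) (h : IsSplit a b x),
        VB.onFiber S.μ x (VB.tmulC h (VB.oneH 𝕜 E a) (VB.oneH 𝕜 E b)) = VB.oneH 𝕜 E x) ∧
      VB.onFiber S.Δ ∅ (VB.oneC 𝕜 E M) = VB.tmulH (VB.oneC 𝕜 E M) (VB.oneC 𝕜 E M) ∧
      (∀ x : UConf M, x ≠ ∅ → VB.onFiber S.Δ x = 0) ∧
      VB.onFiber S.ν ∅ (VB.oneC 𝕜 E M) = VB.oneH 𝕜 E ∅ ∧
      (∀ x : UConf M, x ≠ ∅ → VB.onFiber S.ν x = 0) ∧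
      -- the shuffle map is the inclusion of the summands in which both splits agree
      (∀ (V' W' V'' W'' : VB 𝕜 E M) (a b x : UConf M) (h : IsSplit a b x) (v' : V'.fiber a)
        (w' : W'.fiber a) (v'' : V''.fiber b) (w'' : W''.fiber b),
        VB.onFiber (S.sh V' W' V'' W'') x (VB.tmulC h (VB.tmulH v' w') (VB.tmulH v'' w'')) =
          VB.tmulH (VB.tmulC h v' v'') (VB.tmulC h w' w'')) ∧
      (∀ (V' W' V'' W'' : VB 𝕜 E M) (x : UConf M),
        Function.Injective (VB.onFiber (S.sh V' W' V'' W'') x)) := by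
  refine ⟨VB.twoMonoidalStructure 𝕜 E M, ?_, ?_, ?_, ?_, ?_, ?_, ?_, ?_, ?_, ?_, ?_, ?_, ?_, ?_, ?_⟩
  · exact fun V V' W W' f g x v w => VB.mapH_tmulH f g v w
  · exact fun V W X x v w u => VB.assocH_tmulH v w u
  · exact fun V x v => ⟨VB.leftUnitorH_tmulH v, VB.rightUnitorH_tmulH v⟩
  · exact fun V W x v w => VB.swapH_tmulH v w
  · exact fun V V' W W' f g a b x h v w => VB.mapC_tmulC f g h v w
  · exact fun V W X a b c ab bc x h₁ h₂ h₃ h₄ v w u => VB.assocHomC_tmulC h₁ h₂ h₃ h₄ v w u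
  · intro V x h h' v
    -- The formulas above are stated for the global section `vac`, whose value at `∅` is `oneC`.
    rw [← VB.vac_empty]
    exact ⟨VB.leftUnitorC_tmulC h v, VB.rightUnitorC_tmulC h' v⟩
  · exact fun V W a b x h h' v w => VB.swapC_tmulC h v w
  · exact fun a b x h => VB.mul_tmulC h
  · rw [← VB.vac_empty]
    exact VB.comul_vac
  · exact fun x hx => VB.onFiber_cauchyUnit_eq_zero _ hx
  · rw [← VB.vac_empty]
    exact VB.incl_vac
  · exact fun x hx => VB.onFiber_cauchyUnit_eq_zero _ hx
  · exact fun V' W' V'' W'' a b x h v' w' v'' w'' => VB.shuffle_tmulC h v' w' v'' w''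
  · exact fun V' W' V'' W'' x => VB.shuffle_injective x
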